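/- Let $X_\bullet$ be a $2$-Segal simplicial set, i.e. for every $n\ge 2$ and every triangulation $\mathcal T$ of the convex polygon with vertices $0,\dots,n$, the induced map $X_n\to X_2\times_{X_1}\cdots\times_{X_1}X_2$ is a bijection. Consider the pseudomonoid in the monoidal bicategory $\mathrm{Span}$ of spans of sets that it determines: the underlying object is $X_1$, the multiplication $\mu$ is the span $X_1\times X_1\xleftarrow{(d_2,d_0)}X_2\xrightarrow{d_1}X_1$, the unit is $\{\bullet\}\leftarrow X_0\xrightarrow{s_0}X_1$, the associator is the composite of the inverse of $(d_3,d_1)\colon X_3\to X_2\times_{X_1}X_2$ with $(d_2,d_0)\colon X_3\to X_2\times_{X_1}X_2$, and the unitors are the inverses of the bijections $(d_1,s_0)\colon X_1\to X_0\times_{X_1}X_2$ and $(s_1,d_0)\colon X_1\to X_2\times_{X_1}X_0$. A paracyclic structure on $X_\bullet$ is a family of bijections $\tau^n\colon X_n\to X_n$, $n\ge 0$, such that $d_i\tau^n=\tau^{n-1}d_{i+1}$ for $i<n$ and $d_n\tau^n=d_0$ (for $n\ge 1$), and $s_i\tau^n=\tau^{n+1}s_{i+1}$ for $i<n$ and $s_n\tau^n=(\tau^{n+1})^2s_0$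 (for $n\ge 0$). A Frobenius structure on the pseudomonoid is a span $\varepsilon\colon X_1\to\{\bullet\}$ (the counit) such that the pairing $\alpha=\varepsilon\circ\mu$ is biexact: there are a copairing $\beta\colon\{\bullet\}\to X_1\times X_1$ and invertible $2$-morphisms $z\colon(\mathrm{id}\times\alpha)\circ(\beta\times\mathrm{id})\Rightarrow\mathrm{id}$ and $n\colon(\alpha\times\mathrm{id})\circ(\mathrm{id}\times\beta)\Rightarrow\mathrm{id}$ such that applying $z$ or $n$ gives the same $2$-morphism $(\alpha\times\alpha)\circ(\mathrm{id}\times\beta\times\mathrm{id})\Rightarrow\alpha$, and the same $2$-morphism $(\mathrm{id}\times\alpha\times\mathrm{id})\circ(\beta\times\beta)\Rightarrow\beta$. Two Frobenius structures are equivalent if their counits are $2$-isomorphic. Then for every paracyclic structure $(\tau^n)_n$ on $X_\bullet$ the span $X_1\xleftarrow{\tau^1s_0}X_0\to\{\bullet\}$ is the counit of a Frobenius structure, and sending $(\tau^n)_n$ to the equivalence class of this Frobenius structure is a bijection from the set of paracyclic structures on $X_\bullet$ to the equivalence classes of Frobenius structures on the pseudomonoid. Moreover, $(\tau^n)_n\mapsto(\tau^{n+1}s_0\colon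 X_n\to X_{n+1})_n$ is a bijection from the paracyclic structures on $X_\bullet$ to the systems of extra degeneracy maps, i.e. families $s^n_{n+1}\colon X_n\to X_{n+1}$, $n\ge 0$, with $d_is^n_{n+1}=s^{n-1}_nd_i$ for $0<i<n+1$, $d_{n+1}s^n_{n+1}=\mathrm{id}$, $s_is^n_{n+1}=s^{n+1}_{n+2}s_i$ for $0\le i\le n$, $s_{n+1}s^n_{n+1}=s^{n+1}_{n+2}s^n_{n+1}$ (where $s_{n+1}$ on the left is the last ordinary degeneracy of $X_{n+1}$), and $d_0s^n_{n+1}$ bijective for all $n$; its inverse is given by $\tau^n=d_0s^n_{n+1}$. -/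

import Mathlib

open CategoryTheory Simplicial Opposite

universe u

/-! ## Spans of sets -/

/-- A span of sets `A ← apex → B`, a `1`-morphism from `A` to `B` in the bicategory of spans. -/
structure SetSpan (A B : Type u) : Type (u + 1) where
  /-- the apex -/
  apex : Type u
  /-- the leg to the source -/
  left : apex → A
  /-- the leg to the target -/
  right : apex → B

namespace SetSpan

/-- A `2`-morphism of spans: a map of apexes commuting with both legs. -/
@[ext]
structure Hom {A B : Type u} (S T : SetSpan A B) : Type u where
  /-- the map of apexes -/
  toFun : S.apex → T.apex
  left_toFun : ∀ s, T.left (toFun s) = S.left s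
  right_toFun : ∀ s, T.right (toFun s) = S.right s

/-- An invertible `2`-morphism of spans. -/
structure Iso {A B : Type u} (S T : SetSpan A B) : Type u where
  /-- the bijection of apexes -/
  toEquiv : S.apex ≃ T.apex
  left_toEquiv : ∀ s, T.left (toEquiv s) = S.left s
  right_toEquiv : ∀ s, T.right (toEquiv s) = S.right s

namespace Iso

/-- The identity `2`-isomorphism. -/
def refl {A B : Type u} (S : SetSpan A B) : Iso S S :=
  ⟨Equiv.refl _, fun _ => rfl, fun _ => rfl⟩

/-- The inverse of a `2`-isomorphism. -/
def symm {A B : Type u} {S T : SetSpan A B} (f : Iso S T) : Iso T S where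
  toEquiv := f.toEquiv.symm
  left_toEquiv t := by
    rw [← f.left_toEquiv, Equiv.apply_symm_apply]
  right_toEquiv t := by
    rw [← f.right_toEquiv, Equiv.apply_symm_apply]

/-- The vertical composite of `2`-isomorphisms. -/
def trans {A B : Type u} {S T U : SetSpan A B} (f : Iso S T) (g : Iso T U) : Iso S U where
  toEquiv := f.toEquiv.trans g.toEquiv
  left_toEquiv s := (g.left_toEquiv _).trans (f.left_toEquiv s)
  right_toEquiv s := (g.right_toEquiv _).trans (f.right_toEquiv s)

end Iso

/-- The identity span. -/
def id (A : Type u) : SetSpan A A := ⟨A, fun a => a, fun a => a⟩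

/-- The composite `T ∘ S` of spans (in diagrammatic order), with apex the fibre product. -/
def comp {A B C : Type u} (S : SetSpan A B) (T : SetSpan B C) : SetSpan A C where
  apex := {p : S.apex × T.apex // S.right p.1 = T.left p.2}
  left p := S.left p.1.1
  right p := T.right p.1.2

/-- The monoidal product of spans, induced by the Cartesian product of sets. -/
def prod {A B A' B' : Type u} (S : SetSpan A B) (T : SetSpan A' B') :
    SetSpan (A × A') (B × B') where
  apex := S.apex × T.apex
  left p := (S.left p.1, T.left p.2)
  right p := (S.right p.1, T.right p.2)

/-- Transport of a span along bijections of its source and target. It is used to insert the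
rebracketing bijections `(A × B) × C ≃ A × (B × C)` and the bijections
`PUnit × A ≃ A ≃ A × PUnit`, which are the associators and unitors of the monoidal structure. -/
def relabel {A B A' B' : Type u} (S : SetSpan A B) (e : A ≃ A') (f : B ≃ B') :
    SetSpan A' B' where
  apex := S.apex
  left s := e (S.left s)
  right s := f (S.right s)

end SetSpan

/-! ## Pseudomonoids in spans -/

namespace SetSpan

/-- The span `μ ∘ (μ ⊗ id)`. -/
def mulLeft {X : Type u} (μ : SetSpan (X × X) X) : SetSpan ((X × X) × X) X :=
  (μ.prod (id X)).comp μ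

/-- The span `μ ∘ (id ⊗ μ)`, with source rebracketed to `(X × X) × X`. -/
def mulRight {X : Type u} (μ : SetSpan (X × X) X) : SetSpan ((X × X) × X) X :=
  (((id X).prod μ).comp μ).relabel (Equiv.prodAssoc X X X).symm (Equiv.refl X)

/-- The span `μ ∘ (η ⊗ id)`, with source `PUnit × X` identified with `X`. -/
def unitMul {X : Type u} (η : SetSpan PUnit.{u + 1} X) (μ : SetSpan (X × X) X) : SetSpan X X :=
  ((η.prod (id X)).comp μ).relabel (Equiv.punitProd X) (Equiv.refl X)

/-- The span `μ ∘ (id ⊗ η)`, with source `X × PUnit` identified with `X`. -/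
def mulUnit {X : Type u} (η : SetSpan PUnit.{u + 1} X) (μ : SetSpan (X × X) X) : SetSpan X X :=
  (((id X).prod η).comp μ).relabel (Equiv.prodPUnit X) (Equiv.refl X)

/-- For a `2`-isomorphism `a : μ ∘ (μ ⊗ id) ⇒ μ ∘ (id ⊗ μ)`, the relation saying that `a` sends
the pair `(m, m')` (where the output of `m` is the first input of `m'`) to the pair `(p, p')`
(where the output of `p` is the second input of `p'`). -/
def AssocRel {X : Type u} {μ : SetSpan (X × X) X} (a : Iso μ.mulLeft μ.mulRight)
    (m m' p p' : μ.apex) : Prop :=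
  ∃ h : μ.right m = (μ.left m').1,
    (a.toEquiv ⟨((m, (μ.left m').2), m'), Prod.ext h rfl⟩).1.1.2 = p ∧
    (a.toEquiv ⟨((m, (μ.left m').2), m'), Prod.ext h rfl⟩).1.2 = p'

end SetSpan

open SetSpan in
/-- A pseudomonoid in the monoidal bicategory of spans of sets.

Up to the canonical rebracketings, an element of the apex of a composite of multiplications and
units is a consistent family of elements of the apexes of the vertices of the corresponding string
diagram, and a `2`-morphism placed in a part of the diagram changes only the elements of that
part. The two coherence equations are stated on such families. -/
structure SpanPseudomonoid : Type (u + 1) where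
  /-- the underlying set -/
  carrier : Type u
  /-- the unit `η` -/
  unit : SetSpan PUnit.{u + 1} carrier
  /-- the multiplication `μ` -/
  mul : SetSpan (carrier × carrier) carrier
  /-- the associator `a` -/
  assoc : Iso mul.mulLeft mul.mulRight
  /-- the left unitor `ℓ` -/
  leftUnitor : Iso (unitMul unit mul) (SetSpan.id carrier)
  /-- the right unitor `r` -/
  rightUnitor : Iso (mulUnit unit mul) (SetSpan.id carrier)
  /-- The pentagon equation on a family `(m₁, m₂, m₃)` bracketed as `((x₁ x₂) x₃) x₄`. One side is
  `(m₁, m₂, m₃) ↦ (p, p', m₃) ↦ (p, q, q') ↦ (r, r', q')`; the other is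
  `(m₁, m₂, m₃) ↦ (m₁, b, b') ↦ (b, c, c')`, where the second step includes the interchange of
  the vertices `m₁` and `b`, which lie over disjoint strands. -/
  pentagon : ∀ m₁ m₂ m₃ p p' q q' r r' b b' c c' : mul.apex,
    AssocRel assoc m₁ m₂ p p' → AssocRel assoc p' m₃ q q' → AssocRel assoc p q r r' →
    AssocRel assoc m₂ m₃ b b' → AssocRel assoc m₁ b' c c' →
    r = b ∧ r' = c ∧ q' = c'
  /-- The triangle equation on a family `(e, m, m')` with `e` in the apex of the unit, bracketed as
  `(x₁ e) x₂`. Applying `r` to `(m, e)` leaves `m'`; applying `a` to `(m, m')` gives `(p, p')`, and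
  then applying `ℓ` to `(e, p)` leaves `p'`. -/
  triangle : ∀ (e : unit.apex) (m m' p p' : mul.apex), unit.right e = (mul.left m).2 →
    AssocRel assoc m m' p p' → p' = m'

/-! ## Frobenius pseudomonoids in spans -/

namespace SetSpan

/-- The span `(id ⊗ α) ∘ (β ⊗ id)` from `X` to `X`, up to rebracketing and unit
identifications. -/
def snakeZ {X : Type u} (α : SetSpan (X × X) PUnit.{u + 1}) (β : SetSpan PUnit.{u + 1} (X × X)) :
    SetSpan X X :=
  ((β.prod (id X)).relabel (Equiv.punitProd X) (Equiv.prodAssoc X X X)).comp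
    (((id X).prod α).relabel (Equiv.refl _) (Equiv.prodPUnit X))

/-- The span `(α ⊗ id) ∘ (id ⊗ β)` from `X` to `X`, up to rebracketing and unit
identifications. -/
def snakeN {X : Type u} (α : SetSpan (X × X) PUnit.{u + 1}) (β : SetSpan PUnit.{u + 1} (X × X)) :
    SetSpan X X :=
  (((id X).prod β).relabel (Equiv.prodPUnit X) (Equiv.prodAssoc X X X).symm).comp
    ((α.prod (id X)).relabel (Equiv.refl _) (Equiv.punitProd X))

/-- The span `(α ⊗ α) ∘ (id ⊗ β ⊗ id)`, with apex the set of consistent triples `(a, b, a')`. -/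
def pairingZigzag {X : Type u} (α : SetSpan (X × X) PUnit.{u + 1})
    (β : SetSpan PUnit.{u + 1} (X × X)) : SetSpan (X × X) PUnit.{u + 1} where
  apex := {t : α.apex × β.apex × α.apex //
    (α.left t.1).2 = (β.right t.2.1).1 ∧ (β.right t.2.1).2 = (α.left t.2.2).1}
  left t := ((α.left t.1.1).1, (α.left t.1.2.2).2)
  right _ := PUnit.unit

/-- The span `(id ⊗ α ⊗ id) ∘ (β ⊗ β)`, with apex the set of consistent triples `(b, a, b')`. -/
def copairingZigzag {X : Type u} (α : SetSpan (X × X) PUnit.{u + 1})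
    (β : SetSpan PUnit.{u + 1} (X × X)) : SetSpan PUnit.{u + 1} (X × X) where
  apex := {t : β.apex × α.apex × β.apex //
    (β.right t.1).2 = (α.left t.2.1).1 ∧ (α.left t.2.1).2 = (β.right t.2.2).1}
  left _ := PUnit.unit
  right t := ((β.right t.1.1).1, (β.right t.1.2.2).2)

/-- The legs of the first snake agree once it is isomorphic to the identity. -/
theorem snakeZ_legs {X : Type u} {α : SetSpan (X × X) PUnit.{u + 1}}
    {β : SetSpan PUnit.{u + 1} (X × X)} (z : Iso (snakeZ α β) (id X)) (b : β.apex) (a : α.apex)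
    (h : (β.right b).2 = (α.left a).1) : (β.right b).1 = (α.left a).2 :=
  let e : (snakeZ α β).apex :=
    ⟨((b, (α.left a).2), ((β.right b).1, a)), Prod.ext rfl (Prod.ext h rfl)⟩
  (z.right_toEquiv e).symm.trans (z.left_toEquiv e)

/-- The legs of the second snake agree once it is isomorphic to the identity. -/
theorem snakeN_legs {X : Type u} {α : SetSpan (X × X) PUnit.{u + 1}}
    {β : SetSpan PUnit.{u + 1} (X × X)} (n : Iso (snakeN α β) (id X)) (a : α.apex) (b : β.apex)
    (h : (α.left a).2 = (β.right b).1) : (α.left a).1 = (β.right b).2 :=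
  let e : (snakeN α β).apex :=
    ⟨(((α.left a).1, b), (a, (β.right b).2)), Prod.ext (Prod.ext rfl h.symm) rfl⟩
  (n.left_toEquiv e).symm.trans (n.right_toEquiv e)

/-- The `2`-morphism obtained by applying `n` to the part `(a, b)` of `(a, b, a')`. This yields
`(n (a, b), a')` in the apex of `α ∘ (id ⊗ id)`, which the unitor identifies with `a'`. -/
def pairingZigzagN {X : Type u} {α : SetSpan (X × X) PUnit.{u + 1}}
    {β : SetSpan PUnit.{u + 1} (X × X)} (n : Iso (snakeN α β) (id X)) :
    Hom (pairingZigzag α β) α where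
  toFun t := t.1.2.2
  left_toFun t := Prod.ext (((snakeN_legs n _ _ t.2.1).trans t.2.2).symm) rfl
  right_toFun _ := rfl

/-- The `2`-morphism obtained by applying `z` to the part `(b, a')` of `(a, b, a')`. This yields
`(z (b, a'), a)` in the apex of `α ∘ (id ⊗ id)`, which the unitor identifies with `a`. -/
def pairingZigzagZ {X : Type u} {α : SetSpan (X × X) PUnit.{u + 1}}
    {β : SetSpan PUnit.{u + 1} (X × X)} (z : Iso (snakeZ α β) (id X)) :
    Hom (pairingZigzag α β) α where
  toFun t := t.1.1
  left_toFun t := Prod.ext rfl (t.2.1.trans (snakeZ_legs z _ _ t.2.2))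
  right_toFun _ := rfl

/-- The `2`-morphism obtained by applying `n` to the part `(a, b')` of `(b, a, b')`. This yields
`(b, n (a, b'))` in the apex of `(id ⊗ id) ∘ β`, which the unitor identifies with `b`. -/
def copairingZigzagN {X : Type u} {α : SetSpan (X × X) PUnit.{u + 1}}
    {β : SetSpan PUnit.{u + 1} (X × X)} (n : Iso (snakeN α β) (id X)) :
    Hom (copairingZigzag α β) β where
  toFun t := t.1.1
  left_toFun _ := rfl
  right_toFun t := Prod.ext rfl (t.2.1.trans (snakeN_legs n _ _ t.2.2))

/-- The `2`-morphism obtained by applying `z` to the part `(b, a)` of `(b, a, b')`. This yields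
`(b', z (b, a))` in the apex of `(id ⊗ id) ∘ β`, which the unitor identifies with `b'`. -/
def copairingZigzagZ {X : Type u} {α : SetSpan (X × X) PUnit.{u + 1}}
    {β : SetSpan PUnit.{u + 1} (X × X)} (z : Iso (snakeZ α β) (id X)) :
    Hom (copairingZigzag α β) β where
  toFun t := t.1.2.2
  left_toFun _ := rfl
  right_toFun t := Prod.ext (((snakeZ_legs z _ _ t.2.1).trans t.2.2).symm) rfl

/-- A pairing `α` is biexact if there are a copairing `β` and invertible `2`-morphisms `z`, `n`
from the two snakes to the identity satisfying the two coherence equations. -/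
def Biexact {X : Type u} (α : SetSpan (X × X) PUnit.{u + 1}) : Prop :=
  ∃ (β : SetSpan PUnit.{u + 1} (X × X)) (z : Iso (snakeZ α β) (id X))
    (n : Iso (snakeN α β) (id X)),
    pairingZigzagN n = pairingZigzagZ z ∧ copairingZigzagN n = copairingZigzagZ z

end SetSpan

namespace SpanPseudomonoid

/-- A Frobenius structure on a pseudomonoid: a counit `ε` such that the pairing `ε ∘ μ` is
biexact. -/
structure FrobeniusStructure (P : SpanPseudomonoid.{u}) : Type (u + 1) where
  /-- the counit `ε` -/
  counit : SetSpan P.carrier PUnit.{u + 1}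
  biexact : SetSpan.Biexact (P.mul.comp counit)

/-- Two Frobenius structures are equivalent if their counits are `2`-isomorphic. -/
instance FrobeniusStructure.setoid (P : SpanPseudomonoid.{u}) : Setoid (FrobeniusStructure P) where
  r F G := Nonempty (SetSpan.Iso F.counit G.counit)
  iseqv := ⟨fun _ => ⟨SetSpan.Iso.refl _⟩, fun ⟨f⟩ => ⟨f.symm⟩, fun ⟨f⟩ ⟨g⟩ => ⟨f.trans g⟩⟩

end SpanPseudomonoid

/-! ## Triangulations of polygons and `2`-Segal sets -/

/-- Two chords `c`, `d` (with `c.1 < c.2`, `d.1 < d.2`) of the polygon with vertices `0, …, n` in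
cyclic order cross in their interiors. -/
def ChordsCross {n : ℕ} (c d : Fin (n + 1) × Fin (n + 1)) : Prop :=
  (c.1 < d.1 ∧ d.1 < c.2 ∧ c.2 < d.2) ∨ (d.1 < c.1 ∧ c.1 < d.2 ∧ d.2 < c.2)

/-- A triangulation of the convex polygon with vertices `0, …, n`, given by a maximal set of
pairwise noncrossing chords (the sides of the polygon included). -/
structure PolygonTriangulation (n : ℕ) where
  /-- the chords -/
  chords : Set (Fin (n + 1) × Fin (n + 1))
  lt_of_mem : ∀ c ∈ chords, c.1 < c.2
  noncrossing : ∀ c ∈ chords, ∀ d ∈ chords, ¬ ChordsCross c d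
  maximal : ∀ c : Fin (n + 1) × Fin (n + 1), c.1 < c.2 →
    (∀ d ∈ chords, ¬ ChordsCross c d) → c ∈ chords

/-- The triangles of a triangulation, given by their vertices in increasing order. -/
def PolygonTriangulation.Triangle {n : ℕ} (T : PolygonTriangulation n) : Type :=
  {t : Fin 3 ↪o Fin (n + 1) // ∀ i j, i < j → (t i, t j) ∈ T.chords}

namespace SSet

/-- The iterated fibre product `X₂ ×_{X₁} ⋯ ×_{X₁} X₂` attached to a triangulation: the families of
`2`-simplices indexed by the triangles which agree on all edges shared by triangles. -/
def TriangulationLimit (X : SSet.{u}) {n : ℕ} (T : PolygonTriangulation n) : Type u :=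
  {ξ : T.Triangle → X _⦋2⦌ // ∀ (t t' : T.Triangle) (i j : Fin 3),
    (Fin.succAboveOrderEmb i).trans t.1 = (Fin.succAboveOrderEmb j).trans t'.1 →
      X.δ i (ξ t) = X.δ j (ξ t')}

/-- The map `X_n → X₂ ×_{X₁} ⋯ ×_{X₁} X₂` induced by a triangulation. -/
def triangulationMap (X : SSet.{u}) {n : ℕ} (T : PolygonTriangulation n) (ψ : X _⦋n⦌) :
    X.TriangulationLimit T :=
  ⟨fun t => X.map (SimplexCategory.mkHom t.1.toOrderHom).op ψ, by
    intro t t' i j h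
    rw [SimplicialObject.δ_def, SimplicialObject.δ_def, ← Functor.map_comp_apply,
      ← Functor.map_comp_apply, ← op_comp, ← op_comp]
    have h' : SimplexCategory.δ i ≫ SimplexCategory.mkHom t.1.toOrderHom =
        SimplexCategory.δ j ≫ SimplexCategory.mkHom t'.1.toOrderHom := by
      ext k
      exact congrArg Fin.val (DFunLike.congr_fun h k)
    rw [h']⟩

/-- A simplicial set is `2`-Segal if for every triangulation of every `(n + 1)`-gon, `n ≥ 2`, the
induced map is bijective. -/
def IsTwoSegal (X : SSet.{u}) : Prop :=
  ∀ n : ℕ, 2 ≤ n → ∀ T : PolygonTriangulation n, Function.Bijective (X.triangulationMap T)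

end SSet

namespace SSet

/-- The triangulation of the square with diagonal `02`. -/
def squareTriangulation₀₂ : PolygonTriangulation 3 where
  chords := {c | c.1 < c.2 ∧ c ≠ (1, 3)}
  lt_of_mem _ h := h.1
  noncrossing := by
    rintro ⟨a, b⟩ h ⟨c, d⟩ h'
    revert a b c d
    simp only [Set.mem_ofPred_eq, ChordsCross]
    decide
  maximal := by
    rintro ⟨a, b⟩ h h'
    have h1 := h' (0, 2) (by simp)
    clear h'
    revert a b
    simp only [Set.mem_ofPred_eq, ChordsCross]
    decide

/-- The triangulation of the square with diagonal `13`. -/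
def squareTriangulation₁₃ : PolygonTriangulation 3 where
  chords := {c | c.1 < c.2 ∧ c ≠ (0, 2)}
  lt_of_mem _ h := h.1
  noncrossing := by
    rintro ⟨a, b⟩ h ⟨c, d⟩ h'
    revert a b c d
    simp only [Set.mem_ofPred_eq, ChordsCross]
    decide
  maximal := by
    rintro ⟨a, b⟩ h h'
    have h1 := h' (1, 3) (by simp)
    clear h'
    revert a b
    simp only [Set.mem_ofPred_eq, ChordsCross]
    decide

/-- The triangulation of the pentagon with diagonals `02` and `03`. -/
def pentagonTriangulation : PolygonTriangulation 4 where
  chords := {c | c.1 < c.2 ∧ (c.1 = 0 ∨ c.2.val = c.1.val + 1)}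
  lt_of_mem _ h := h.1
  noncrossing := by
    rintro ⟨a, b⟩ h ⟨c, d⟩ h'
    revert a b c d
    simp only [Set.mem_ofPred_eq, ChordsCross]
    decide
  maximal := by
    rintro ⟨a, b⟩ h h'
    have h1 := h' (0, 2) (by simp)
    have h2 := h' (0, 3) (by simp)
    clear h'
    revert a b
    simp only [Set.mem_ofPred_eq, ChordsCross]
    decide

theorem triangle_ext {n : ℕ} {t t' : Fin 3 ↪o Fin (n + 1)} (h0 : t 0 = t' 0) (h1 : t 1 = t' 1)
    (h2 : t 2 = t' 2) : t = t' := by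
  ext k
  fin_cases k
  · exact congrArg Fin.val h0
  · exact congrArg Fin.val h1
  · exact congrArg Fin.val h2

theorem exists_of_triangles {X : SSet.{u}} (hX : X.IsTwoSegal) {n k : ℕ} (hn : 2 ≤ n)
    (T : PolygonTriangulation n) (tri : Fin k → (Fin 3 ↪o Fin (n + 1)))
    (hmem : ∀ p i j, i < j → (tri p i, tri p j) ∈ T.chords)
    (hinj : ∀ p q, tri p 1 = tri q 1 → p = q)
    (hsurj : ∀ a b c, (a, b) ∈ T.chords → (a, c) ∈ T.chords → (b, c) ∈ T.chords →
      ∃ p, tri p 0 = a ∧ tri p 1 = b ∧ tri p 2 = c)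
    (ζ : Fin k → X _⦋2⦌)
    (hζ : ∀ (p q : Fin k) (i j : Fin 3),
      (∀ l, tri p (i.succAbove l) = tri q (j.succAbove l)) → X.δ i (ζ p) = X.δ j (ζ q)) :
    ∃! ψ : X _⦋n⦌, ∀ p, X.map (SimplexCategory.mkHom (tri p).toOrderHom).op ψ = ζ p := by
  let tri' : Fin k → T.Triangle := fun p => ⟨tri p, hmem p⟩
  have htri : Function.Bijective tri' := by
    constructor
    · intro p q hpq
      exact hinj p q (congrArg (fun t : T.Triangle => t.1 1) hpq)
    · rintro ⟨t, ht⟩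
      obtain ⟨p, h0, h1, h2⟩ := hsurj _ _ _ (ht 0 1 (by decide)) (ht 0 2 (by decide))
        (ht 1 2 (by decide))
      exact ⟨p, Subtype.ext (triangle_ext h0 h1 h2)⟩
  let e : Fin k ≃ T.Triangle := Equiv.ofBijective tri' htri
  have he : ∀ p, (e p).1 = tri p := fun _ => rfl
  let ξ : X.TriangulationLimit T := ⟨fun t => ζ (e.symm t), by
    intro t t' i j h
    apply hζ
    intro l
    rw [← he, ← he, Equiv.apply_symm_apply, Equiv.apply_symm_apply]
    exact DFunLike.congr_fun h l⟩
  obtain ⟨ψ, hψ⟩ := (hX n hn T).2 ξ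
  refine ⟨ψ, fun p => ?_, fun ψ' h' => ?_⟩
  · have h1 := congrFun (congrArg Subtype.val hψ) (e p)
    have h2 : ξ.1 (e p) = ζ p := congrArg ζ (e.symm_apply_apply p)
    exact h1.trans h2
  · apply (hX n hn T).1
    rw [hψ]
    apply Subtype.ext
    funext t
    obtain ⟨p, rfl⟩ := e.surjective t
    have h2 : ξ.1 (e p) = ζ p := congrArg ζ (e.symm_apply_apply p)
    exact (h' p).trans h2.symm

theorem square₀₂ {X : SSet.{u}} (hX : X.IsTwoSegal) (ξ ξ' : X _⦋2⦌) (h : X.δ 1 ξ = X.δ 2 ξ') :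
    ∃! ψ : X _⦋3⦌, X.δ 3 ψ = ξ ∧ X.δ 1 ψ = ξ' := by
  have := exists_of_triangles hX (by norm_num) squareTriangulation₀₂
    ![Fin.succAboveOrderEmb 3, Fin.succAboveOrderEmb 1]
    (by change ∀ p i j, i < j → _ < _ ∧ _ ≠ _; decide) (by decide)
    (by
      rintro a b c ⟨h1, h1'⟩ ⟨h2, h2'⟩ ⟨h3, h3'⟩
      simp only [ne_eq, Prod.mk.injEq] at h1 h1' h2 h2' h3 h3'
      revert a b c
      decide)
    ![ξ, ξ'] (by
    intro p q i j
    fin_cases p <;> fin_cases q <;> fin_cases i <;> fin_cases j <;>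
      first
      | exact fun _ => rfl
      | exact fun _ => h
      | exact fun _ => h.symm
      | (intro hl; exfalso; revert hl; change ¬ (∀ l, _); decide))
  obtain ⟨ψ, h1, h2⟩ := this
  exact ⟨ψ, ⟨h1 0, h1 1⟩, fun ψ' h' => h2 ψ' (Fin.forall_fin_two.2 h')⟩

theorem square₁₃ {X : SSet.{u}} (hX : X.IsTwoSegal) (ξ ξ' : X _⦋2⦌) (h : X.δ 1 ξ = X.δ 0 ξ') :
    ∃! ψ : X _⦋3⦌, X.δ 0 ψ = ξ ∧ X.δ 2 ψ = ξ' := by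
  have := exists_of_triangles hX (by norm_num) squareTriangulation₁₃
    ![Fin.succAboveOrderEmb 2, Fin.succAboveOrderEmb 0]
    (by change ∀ p i j, i < j → _ < _ ∧ _ ≠ _; decide) (by decide)
    (by
      rintro a b c ⟨h1, h1'⟩ ⟨h2, h2'⟩ ⟨h3, h3'⟩
      simp only [ne_eq, Prod.mk.injEq] at h1 h1' h2 h2' h3 h3'
      revert a b c
      decide)
    ![ξ', ξ] (by
    intro p q i j
    fin_cases p <;> fin_cases q <;> fin_cases i <;> fin_cases j <;>
      first
      | exact fun _ => rfl
      | exact fun _ => h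
      | exact fun _ => h.symm
      | (intro hl; exfalso; revert hl; change ¬ (∀ l, _); decide))
  obtain ⟨ψ, h1, h2⟩ := this
  exact ⟨ψ, ⟨h1 1, h1 0⟩, fun ψ' h' => h2 ψ' (Fin.forall_fin_two.2 h'.symm)⟩

theorem pentagon_exists {X : SSet.{u}} (hX : X.IsTwoSegal) (ξ₁ ξ₂ ξ₃ : X _⦋2⦌)
    (h : X.δ 1 ξ₁ = X.δ 2 ξ₂) (h' : X.δ 1 ξ₂ = X.δ 2 ξ₃) :
    ∃ ψ : X _⦋4⦌, X.δ 3 (X.δ 4 ψ) = ξ₁ ∧ X.δ 1 (X.δ 4 ψ) = ξ₂ ∧ X.δ 1 (X.δ 2 ψ) = ξ₃ := by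
  have := exists_of_triangles hX (by norm_num) pentagonTriangulation
    ![(Fin.succAboveOrderEmb 3).trans (Fin.succAboveOrderEmb 4),
      (Fin.succAboveOrderEmb 1).trans (Fin.succAboveOrderEmb 4),
      (Fin.succAboveOrderEmb 1).trans (Fin.succAboveOrderEmb 2)]
    (by change ∀ p i j, i < j → _ < _ ∧ (_ ∨ _); decide) (by decide)
    (by
      rintro a b c ⟨h1, h1'⟩ ⟨h2, h2'⟩ ⟨h3, h3'⟩
      simp only at h1 h1' h2 h2' h3 h3'
      revert a b c
      decide)
    ![ξ₁, ξ₂, ξ₃] (by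
    intro p q i j
    fin_cases p <;> fin_cases q <;> fin_cases i <;> fin_cases j <;>
      first
      | exact fun _ => rfl
      | exact fun _ => h
      | exact fun _ => h.symm
      | exact fun _ => h'
      | exact fun _ => h'.symm
      | (intro hl; exfalso; revert hl; change ¬ (∀ l, _); decide))
  obtain ⟨ψ, h1, -⟩ := this
  refine ⟨ψ, ?_, ?_, ?_⟩
  · refine Eq.trans ?_ (h1 0); simp only [SimplicialObject.δ_def, ← Functor.map_comp_apply]; rfl
  · refine Eq.trans ?_ (h1 1); simp only [SimplicialObject.δ_def, ← Functor.map_comp_apply]; rfl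
  · refine Eq.trans ?_ (h1 2); simp only [SimplicialObject.δ_def, ← Functor.map_comp_apply]; rfl

/-- Left unitality of `2`-Segal sets. -/
theorem eq_σ_zero {X : SSet.{u}} (hX : X.IsTwoSegal) (ξ : X _⦋2⦌) (v : X _⦋0⦌)
    (h : X.δ 2 ξ = X.σ 0 v) : ξ = X.σ 0 (X.δ 1 ξ) := by
  have h3 : X.δ 3 (X.σ 0 ξ) = X.δ 3 (X.σ 1 ξ) := by
    have e0 : X.δ 3 (X.σ 0 ξ) = X.σ 0 (X.δ 2 ξ) := X.δ_comp_σ_of_gt_apply (i := 2) (j := 0) (by decide) ξ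
    have e1 : X.δ 3 (X.σ 1 ξ) = X.σ 1 (X.δ 2 ξ) := X.δ_comp_σ_of_gt_apply (i := 2) (j := 1) (by decide) ξ
    rw [e0, e1, h]
    exact X.σ_comp_σ_apply (i := 0) (j := 0) (by decide) v
  have h1 : X.δ 1 (X.σ 0 ξ) = X.δ 1 (X.σ 1 ξ) :=
    (X.δ_comp_σ_succ_apply (0 : Fin 3) ξ).trans (X.δ_comp_σ_self_apply (1 : Fin 3) ξ).symm
  obtain ⟨ψ, -, hu⟩ := square₀₂ hX (X.δ 3 (X.σ 1 ξ)) (X.δ 1 (X.σ 1 ξ))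
    (X.δ_comp_δ_apply (i := 1) (j := 2) (by decide) _)
  have e : X.σ 0 ξ = X.σ 1 ξ := (hu _ ⟨h3, h1⟩).trans (hu _ ⟨rfl, rfl⟩).symm
  have e1 : X.δ 2 (X.σ 1 ξ) = ξ := X.δ_comp_σ_succ_apply (1 : Fin 3) ξ
  rw [← e] at e1
  exact e1.symm.trans (X.δ_comp_σ_of_gt_apply (i := 1) (j := 0) (by decide) ξ)

/-- Right unitality of `2`-Segal sets. -/
theorem eq_σ_one {X : SSet.{u}} (hX : X.IsTwoSegal) (ξ : X _⦋2⦌) (v : X _⦋0⦌)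
    (h : X.δ 0 ξ = X.σ 0 v) : ξ = X.σ 1 (X.δ 1 ξ) := by
  have h0 : X.δ 0 (X.σ 2 ξ) = X.δ 0 (X.σ 1 ξ) := by
    have e0 : X.δ 0 (X.σ 2 ξ) = X.σ 1 (X.δ 0 ξ) := X.δ_comp_σ_of_le_apply (i := 0) (j := 1) (by decide) ξ
    have e1 : X.δ 0 (X.σ 1 ξ) = X.σ 0 (X.δ 0 ξ) := X.δ_comp_σ_of_le_apply (i := 0) (j := 0) (by decide) ξ
    rw [e0, e1, h]
    exact (X.σ_comp_σ_apply (i := 0) (j := 0) (by decide) v).symm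
  have h2 : X.δ 2 (X.σ 2 ξ) = X.δ 2 (X.σ 1 ξ) :=
    (X.δ_comp_σ_self_apply (2 : Fin 3) ξ).trans (X.δ_comp_σ_succ_apply (1 : Fin 3) ξ).symm
  obtain ⟨ψ, -, hu⟩ := square₁₃ hX (X.δ 0 (X.σ 1 ξ)) (X.δ 2 (X.σ 1 ξ))
    (X.δ_comp_δ_apply (i := 0) (j := 1) (by decide) _).symm
  have e : X.σ 2 ξ = X.σ 1 ξ := (hu _ ⟨h0, h2⟩).trans (hu _ ⟨rfl, rfl⟩).symm
  have e1 : X.δ 1 (X.σ 1 ξ) = ξ := X.δ_comp_σ_self_apply (1 : Fin 3) ξ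
  rw [← e] at e1
  exact e1.symm.trans (X.δ_comp_σ_of_le_apply (i := 1) (j := 1) (by decide) ξ)

/-! ## The pseudomonoid of a `2`-Segal set -/

/-- The multiplication span `X₁ × X₁ ← X₂ → X₁` with legs `(d₂, d₀)` and `d₁`. -/
def mulSpan (X : SSet.{u}) : SetSpan (X _⦋1⦌ × X _⦋1⦌) (X _⦋1⦌) where
  apex := X _⦋2⦌
  left ξ := (X.δ 2 ξ, X.δ 0 ξ)
  right ξ := X.δ 1 ξ

/-- The unit span `PUnit ← X₀ → X₁` with right leg `s₀`. -/
def unitSpan (X : SSet.{u}) : SetSpan PUnit.{u + 1} (X _⦋1⦌) where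
  apex := X _⦋0⦌
  left _ := PUnit.unit
  right v := X.σ 0 v

/-- The map `X₃ → X₂ ×_{X₁} X₂`, `ψ ↦ (d₃ ψ, d₁ ψ)`, into the apex of `μ ∘ (μ ⊗ id)`. -/
def toMulLeft (X : SSet.{u}) (ψ : X _⦋3⦌) : X.mulSpan.mulLeft.apex :=
  ⟨((X.δ 3 ψ, X.δ 0 (X.δ 1 ψ)), X.δ 1 ψ),
    Prod.ext (X.δ_comp_δ_apply (i := 1) (j := 2) (by decide) ψ) rfl⟩

/-- The map `X₃ → X₂ ×_{X₁} X₂`, `ψ ↦ (d₂ ψ, d₀ ψ)`, into the apex of `μ ∘ (id ⊗ μ)` (the upper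
vertex `d₀ ψ` is written first). -/
def toMulRight (X : SSet.{u}) (ψ : X _⦋3⦌) : X.mulSpan.mulRight.apex :=
  ⟨((X.δ 2 (X.δ 2 ψ), X.δ 0 ψ), X.δ 2 ψ),
    Prod.ext rfl (X.δ_comp_δ_apply (i := 0) (j := 1) (by decide) ψ).symm⟩

theorem toMulLeft_bijective {X : SSet.{u}} (hX : X.IsTwoSegal) :
    Function.Bijective X.toMulLeft := by
  constructor
  · intro ψ ψ' h
    have h' := congrArg Subtype.val h
    have h3 : X.δ 3 ψ = X.δ 3 ψ' := congrArg (fun q => q.1.1) h'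
    have h1 : X.δ 1 ψ = X.δ 1 ψ' := congrArg (fun q => q.2) h'
    exact (square₀₂ hX _ _ (X.δ_comp_δ_apply (i := 1) (j := 2) (by decide) ψ')).unique
      ⟨h3, h1⟩ ⟨rfl, rfl⟩
  · rintro ⟨⟨⟨m, x⟩, m'⟩, h⟩
    have h0 : X.δ 1 m = X.δ 2 m' := congrArg Prod.fst h
    have hx : x = X.δ 0 m' := congrArg Prod.snd h
    obtain ⟨ψ, ⟨e3, e1⟩, -⟩ := square₀₂ hX m m' h0
    refine ⟨ψ, Subtype.ext (Prod.ext (Prod.ext e3 ?_) e1)⟩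
    exact (congrArg (X.δ 0) e1).trans hx.symm

theorem toMulRight_bijective {X : SSet.{u}} (hX : X.IsTwoSegal) :
    Function.Bijective X.toMulRight := by
  constructor
  · intro ψ ψ' h
    have h' := congrArg Subtype.val h
    have h0 : X.δ 0 ψ = X.δ 0 ψ' := congrArg (fun q => q.1.2) h'
    have h2 : X.δ 2 ψ = X.δ 2 ψ' := congrArg (fun q => q.2) h'
    exact (square₁₃ hX _ _ (X.δ_comp_δ_apply (i := 0) (j := 1) (by decide) ψ').symm).unique
      ⟨h0, h2⟩ ⟨rfl, rfl⟩
  · rintro ⟨⟨⟨x, m⟩, m'⟩, h⟩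
    have h0 : X.δ 1 m = X.δ 0 m' := congrArg Prod.snd h
    have hx : x = X.δ 2 m' := congrArg Prod.fst h
    obtain ⟨ψ, ⟨e0, e2⟩, -⟩ := square₁₃ hX m m' h0
    refine ⟨ψ, Subtype.ext (Prod.ext (Prod.ext ?_ e0) e2)⟩
    exact (congrArg (X.δ 2) e2).trans hx.symm

/-- The associator: the composite of the inverse of `ψ ↦ (d₃ ψ, d₁ ψ)` with
`ψ ↦ (d₂ ψ, d₀ ψ)`. -/
noncomputable def segalAssociator (X : SSet.{u}) (hX : X.IsTwoSegal) :
    SetSpan.Iso X.mulSpan.mulLeft X.mulSpan.mulRight where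
  toEquiv := (Equiv.ofBijective _ (toMulLeft_bijective hX)).symm.trans
    (Equiv.ofBijective _ (toMulRight_bijective hX))
  left_toEquiv s := by
    obtain ⟨ψ, rfl⟩ := (Equiv.ofBijective _ (toMulLeft_bijective hX)).surjective s
    rw [Equiv.trans_apply, Equiv.symm_apply_apply]
    exact Prod.ext (Prod.ext (X.δ_comp_δ_apply (i := 2) (j := 2) (by decide) ψ).symm
      (X.δ_comp_δ_apply (i := 0) (j := 2) (by decide) ψ).symm)
      (X.δ_comp_δ_apply (i := 0) (j := 0) (by decide) ψ).symm
  right_toEquiv s := by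
    obtain ⟨ψ, rfl⟩ := (Equiv.ofBijective _ (toMulLeft_bijective hX)).surjective s
    rw [Equiv.trans_apply, Equiv.symm_apply_apply]
    exact X.δ_comp_δ_apply (i := 1) (j := 1) (by decide) ψ

/-- The left unitor, inverse to `x ↦ (d₁ x, s₀ x)`. -/
def segalLeftUnitor (X : SSet.{u}) (hX : X.IsTwoSegal) :
    SetSpan.Iso (SetSpan.unitMul X.unitSpan X.mulSpan) (SetSpan.id (X _⦋1⦌)) where
  toEquiv :=
    { toFun := fun p => X.δ 1 p.1.2
      invFun := fun x => ⟨((X.δ 1 x, x), X.σ 0 x), Prod.ext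
        (X.δ_comp_σ_of_gt_apply (i := 1) (j := 0) (by decide) x).symm
        (X.δ_comp_σ_self_apply 0 x).symm⟩
      left_inv := by
        rintro ⟨⟨⟨v, x⟩, ξ⟩, h⟩
        have hv : X.σ 0 v = X.δ 2 ξ := congrArg Prod.fst h
        have hx : x = X.δ 0 ξ := congrArg Prod.snd h
        have e : ξ = X.σ 0 (X.δ 1 ξ) := eq_σ_zero hX ξ v hv.symm
        have hx' : x = X.δ 1 ξ := by
          rw [hx]
          exact (congrArg (X.δ 0) e).trans (X.δ_comp_σ_self_apply 0 _)
        have hv' : v = X.δ 1 (X.δ 1 ξ) :=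
          (X.δ_comp_σ_succ_apply 0 v).symm.trans ((congrArg (X.δ 1) hv).trans
            (X.δ_comp_δ_apply (i := 1) (j := 1) (by decide) ξ))
        exact Subtype.ext (Prod.ext (Prod.ext hv'.symm hx'.symm) e.symm)
      right_inv := fun x => X.δ_comp_σ_succ_apply 0 x }
  left_toEquiv := by
    rintro ⟨⟨⟨v, x⟩, ξ⟩, h⟩
    have hv : X.σ 0 v = X.δ 2 ξ := congrArg Prod.fst h
    have hx : x = X.δ 0 ξ := congrArg Prod.snd h
    have e : ξ = X.σ 0 (X.δ 1 ξ) := eq_σ_zero hX ξ v hv.symm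
    have e0 : X.δ 0 (X.σ 0 (X.δ 1 ξ)) = X.δ 1 ξ := X.δ_comp_σ_self_apply (0 : Fin 2) (X.δ 1 ξ)
    rw [← e] at e0
    exact e0.symm.trans hx.symm
  right_toEquiv _ := rfl

/-- The right unitor, inverse to `x ↦ (d₀ x, s₁ x)`. -/
def segalRightUnitor (X : SSet.{u}) (hX : X.IsTwoSegal) :
    SetSpan.Iso (SetSpan.mulUnit X.unitSpan X.mulSpan) (SetSpan.id (X _⦋1⦌)) where
  toEquiv :=
    { toFun := fun p => X.δ 1 p.1.2
      invFun := fun x => ⟨((x, X.δ 0 x), X.σ 1 x), Prod.ext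
        (X.δ_comp_σ_succ_apply 1 x).symm
        (X.δ_comp_σ_of_le_apply (i := 0) (j := 0) (by decide) x).symm⟩
      left_inv := by
        rintro ⟨⟨⟨x, v⟩, ξ⟩, h⟩
        have hx : x = X.δ 2 ξ := congrArg Prod.fst h
        have hv : X.σ 0 v = X.δ 0 ξ := congrArg Prod.snd h
        have e : ξ = X.σ 1 (X.δ 1 ξ) := eq_σ_one hX ξ v hv.symm
        have hx' : x = X.δ 1 ξ := by
          rw [hx]
          exact (congrArg (X.δ 2) e).trans (X.δ_comp_σ_succ_apply 1 _)
        have hv' : v = X.δ 0 (X.δ 1 ξ) :=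
          (X.δ_comp_σ_self_apply 0 v).symm.trans ((congrArg (X.δ 0) hv).trans
            (X.δ_comp_δ_apply (i := 0) (j := 0) (by decide) ξ).symm)
        exact Subtype.ext (Prod.ext (Prod.ext hx'.symm hv'.symm) e.symm)
      right_inv := fun x => X.δ_comp_σ_self_apply (1 : Fin 2) x }
  left_toEquiv := by
    rintro ⟨⟨⟨x, v⟩, ξ⟩, h⟩
    have hx : x = X.δ 2 ξ := congrArg Prod.fst h
    have hv : X.σ 0 v = X.δ 0 ξ := congrArg Prod.snd h
    have e : ξ = X.σ 1 (X.δ 1 ξ) := eq_σ_one hX ξ v hv.symm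
    have e2 : X.δ 2 (X.σ 1 (X.δ 1 ξ)) = X.δ 1 ξ := X.δ_comp_σ_succ_apply (1 : Fin 2) (X.δ 1 ξ)
    rw [← e] at e2
    exact e2.symm.trans hx.symm
  right_toEquiv _ := rfl

theorem assocRel_faces {X : SSet.{u}} (hX : X.IsTwoSegal) {m m' p p' : X _⦋2⦌}
    (h : SetSpan.AssocRel (μ := X.mulSpan) (X.segalAssociator hX) m m' p p') (χ : X _⦋3⦌)
    (h3 : X.δ 3 χ = m) (h1 : X.δ 1 χ = m') : p = X.δ 0 χ ∧ p' = X.δ 2 χ := by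
  obtain ⟨h0, e, e'⟩ := h
  subst h3 h1
  have key : (X.segalAssociator hX).toEquiv (X.toMulLeft χ) = X.toMulRight χ :=
    congrArg X.toMulRight ((Equiv.ofBijective _ (toMulLeft_bijective hX)).symm_apply_apply χ)
  have key' := congrArg Subtype.val key
  exact ⟨e.symm.trans (congrArg (fun q => q.1.2) key'),
    e'.symm.trans (congrArg (fun q => q.2) key')⟩

/-- The pseudomonoid in spans determined by a `2`-Segal set. -/
noncomputable def pseudomonoid (X : SSet.{u}) (hX : X.IsTwoSegal) : SpanPseudomonoid.{u} where
  carrier := X _⦋1⦌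
  unit := X.unitSpan
  mul := X.mulSpan
  assoc := X.segalAssociator hX
  leftUnitor := X.segalLeftUnitor hX
  rightUnitor := X.segalRightUnitor hX
  pentagon := by
    intro m₁ m₂ m₃ p p' q q' r r' b b' c c' h₁ h₂ h₃ h₄ h₅
    obtain ⟨ψ, e₁, e₂, e₃⟩ := pentagon_exists hX m₁ m₂ m₃ (congrArg id h₁.1) (congrArg id h₄.1)
    obtain ⟨hp, hp'⟩ := assocRel_faces hX h₁ (X.δ 4 ψ) e₁ e₂
    obtain ⟨hq, hq'⟩ := assocRel_faces hX h₂ (X.δ 2 ψ)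
      ((X.δ_comp_δ_apply (i := 2) (j := 3) (by decide) ψ).symm.trans hp'.symm) e₃
    obtain ⟨hr, hr'⟩ := assocRel_faces hX h₃ (X.δ 0 ψ)
      ((X.δ_comp_δ_apply (i := 0) (j := 3) (by decide) ψ).symm.trans hp.symm)
      ((X.δ_comp_δ_apply (i := 0) (j := 1) (by decide) ψ).symm.trans hq.symm)
    obtain ⟨hb, hb'⟩ := assocRel_faces hX h₄ (X.δ 1 ψ)
      ((X.δ_comp_δ_apply (i := 1) (j := 3) (by decide) ψ).symm.trans e₂)
      ((X.δ_comp_δ_apply (i := 1) (j := 1) (by decide) ψ).symm.trans e₃)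
    obtain ⟨hc, hc'⟩ := assocRel_faces hX h₅ (X.δ 3 ψ)
      ((X.δ_comp_δ_apply (i := 3) (j := 3) (by decide) ψ).symm.trans e₁)
      ((X.δ_comp_δ_apply (i := 1) (j := 2) (by decide) ψ).trans hb'.symm)
    refine ⟨?_, ?_, ?_⟩
    · rw [hr, hb]; exact X.δ_comp_δ_apply (i := 0) (j := 0) (by decide) ψ |>.symm
    · rw [hr', hc]; exact X.δ_comp_δ_apply (i := 0) (j := 2) (by decide) ψ |>.symm
    · rw [hq', hc']; exact X.δ_comp_δ_apply (i := 2) (j := 2) (by decide) ψ |>.symm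
  triangle := by
    intro e m m' p p' he h
    have hm : m = X.σ 1 (X.δ 1 m) := eq_σ_one hX m e (Eq.symm he)
    have h0 : X.δ 1 m = X.δ 2 m' := h.1
    have h3 : X.δ 3 (X.σ 1 m') = m := by
      refine (X.δ_comp_σ_of_gt_apply (i := 2) (j := 1) (by decide) m').trans ?_
      rw [← h0]
      exact hm.symm
    exact (assocRel_faces hX h (X.σ 1 m') h3 (X.δ_comp_σ_self_apply (1 : Fin 3) m')).2.trans
      (X.δ_comp_σ_succ_apply (1 : Fin 3) m')

/-! ## Paracyclic structures -/

/-- A paracyclic structure on a simplicial set: a `ℤ`-action on each `X_n`, given by the bijection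
`τⁿ` by which the generator acts, compatible with the face and degeneracy maps. -/
@[ext]
structure ParacyclicStructure (X : SSet.{u}) : Type u where
  /-- the bijections `τⁿ` -/
  τ : ∀ n : ℕ, X _⦋n⦌ ≃ X _⦋n⦌
  /-- `dᵢ τⁿ⁺¹ = τⁿ dᵢ₊₁` for `i ≤ n` -/
  δ_τ : ∀ (n : ℕ) (i : Fin (n + 1)) (x : X _⦋n + 1⦌),
    X.δ i.castSucc (τ (n + 1) x) = τ n (X.δ i.succ x)
  /-- `dₙ₊₁ τⁿ⁺¹ = d₀` -/
  δ_last_τ : ∀ (n : ℕ) (x : X _⦋n + 1⦌), X.δ (Fin.last (n + 1)) (τ (n + 1) x) = X.δ 0 x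
  /-- `sᵢ τⁿ = τⁿ⁺¹ sᵢ₊₁` for `i < n` -/
  σ_τ : ∀ (n : ℕ) (i : Fin n) (x : X _⦋n⦌),
    X.σ i.castSucc (τ n x) = τ (n + 1) (X.σ i.succ x)
  /-- `sₙ τⁿ = (τⁿ⁺¹)² s₀` -/
  σ_last_τ : ∀ (n : ℕ) (x : X _⦋n⦌),
    X.σ (Fin.last n) (τ n x) = τ (n + 1) (τ (n + 1) (X.σ 0 x))

/-- A system of extra degeneracy maps `sⁿₙ₊₁ : X_n → X_{n+1}`, satisfying the simplicial relations
with the exception of the one for `d₀ sⁿₙ₊₁`, which is only required to be bijective. -/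
@[ext]
structure ExtraDegeneracies (X : SSet.{u}) : Type u where
  /-- the extra degeneracies -/
  s : ∀ n : ℕ, X _⦋n⦌ → X _⦋n + 1⦌
  /-- `dᵢ sⁿ⁺¹ₙ₊₂ = sⁿₙ₊₁ dᵢ` for `0 < i < n + 2` -/
  δ_s : ∀ (n : ℕ) (i : Fin (n + 1)) (x : X _⦋n + 1⦌),
    X.δ i.succ.castSucc (s (n + 1) x) = s n (X.δ i.succ x)
  /-- `dₙ₊₁ sⁿₙ₊₁ = id` -/
  δ_last_s : ∀ (n : ℕ) (x : X _⦋n⦌), X.δ (Fin.last (n + 1)) (s n x) = x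
  /-- `sᵢ sⁿₙ₊₁ = sⁿ⁺¹ₙ₊₂ sᵢ` for `i ≤ n` -/
  σ_s : ∀ (n : ℕ) (i : Fin (n + 1)) (x : X _⦋n⦌),
    X.σ i.castSucc (s n x) = s (n + 1) (X.σ i x)
  /-- `sₙ₊₁ sⁿₙ₊₁ = sⁿ⁺¹ₙ₊₂ sⁿₙ₊₁`, where `sₙ₊₁` is the last ordinary degeneracy -/
  σ_last_s : ∀ (n : ℕ) (x : X _⦋n⦌), X.σ (Fin.last (n + 1)) (s n x) = s (n + 1) (s n x)
  /-- the maps `d₀ sⁿₙ₊₁` are bijective -/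
  bijective : ∀ n : ℕ, Function.Bijective fun x : X _⦋n⦌ => X.δ 0 (s n x)

/-- The span `X₁ ← X₀ → PUnit` with left leg the extra degeneracy `s⁰₁ = τ¹ s₀`. -/
def ParacyclicStructure.counitSpan {X : SSet.{u}} (P : X.ParacyclicStructure) :
    SetSpan (X _⦋1⦌) PUnit.{u + 1} where
  apex := X _⦋0⦌
  left v := P.τ 1 (X.σ 0 v)
  right _ := PUnit.unit

end SSet

/-! In spans of sets a pairing `α` on `A` is biexact if and only if both legs of `α` to `A` are
bijections. Hence the counits of Frobenius structures are, up to isomorphism, the sets `E` of edges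
such that every edge is the first edge, and also the last edge, of a unique triangle whose long edge
lies in `E`. In a fan triangulation the triangle on the long edge can be cut off as an ear, so by
the `2`-Segal condition this unique filling property passes to all dimensions: every `n`-simplex is
the last face of a unique `(n + 1)`-simplex with long edge in `E`, and uniqueness makes these
simplices a system of extra degeneracies. Conversely the edges `s⁰₁ v` of such a system form a set
`E` of this kind: the inverse of `τ²` carries the triangles with long edge in `E` to those whose
first edge is degenerate, and on a `2`-Segal set the latter triangles are degenerate themselves. -/

namespace SetSpan

theorem Iso.range_left_eq {A B : Type u} {S T : SetSpan A B} (f : Iso S T) :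
    Set.range S.left = Set.range T.left := by
  rw [← f.toEquiv.surjective.range_comp T.left]
  exact congrArg Set.range (funext f.left_toEquiv).symm

theorem nonempty_iso_of_range_left_eq {A : Type u} {S T : SetSpan A PUnit.{u + 1}}
    (hS : S.left.Injective) (hT : T.left.Injective) (h : Set.range S.left = Set.range T.left) :
    Nonempty (Iso S T) :=
  ⟨{ toEquiv := (Equiv.ofInjective _ hS).trans
        ((Equiv.setCongr h).trans (Equiv.ofInjective _ hT).symm)
     left_toEquiv := fun _ => Equiv.apply_ofInjective_symm hT _
     right_toEquiv := fun _ => rfl }⟩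

/-- A subset `E` of `A`, regarded as a span from `A` to the point. -/
def ofSet {A : Type u} (E : Set A) : SetSpan A PUnit.{u + 1} where
  apex := E
  left := Subtype.val
  right _ := PUnit.unit

theorem nonempty_iso_id_iff {A : Type u} {S : SetSpan A A} :
    Nonempty (Iso S (id A)) ↔ S.left = S.right ∧ S.left.Bijective := by
  refine ⟨fun ⟨f⟩ => ?_, fun ⟨h, hS⟩ => ⟨⟨Equiv.ofBijective _ hS, fun _ => rfl, congrFun h⟩⟩⟩
  have hl : ⇑f.toEquiv = S.left := funext f.left_toEquiv
  exact ⟨hl.symm.trans (funext f.right_toEquiv), hl ▸ f.toEquiv.bijective⟩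

section Biexact

variable {X : Type u} {α : SetSpan (X × X) PUnit.{u + 1}} {β : SetSpan PUnit.{u + 1} (X × X)}

/-- The element of the apex of `snakeZ α β` given by a pair `(b, a)` with matching inner legs. -/
def snakeZMk (b : β.apex) (a : α.apex) (h : (β.right b).2 = (α.left a).1) :
    (snakeZ α β).apex :=
  ⟨((b, (α.left a).2), ((β.right b).1, a)), Prod.ext rfl (Prod.ext h rfl)⟩

/-- The element of the apex of `snakeN α β` given by a pair `(a, b)` with matching inner legs. -/
def snakeNMk (a : α.apex) (b : β.apex) (h : (α.left a).2 = (β.right b).1) :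
    (snakeN α β).apex :=
  ⟨(((α.left a).1, b), (a, (β.right b).2)), Prod.ext (Prod.ext rfl h.symm) rfl⟩

theorem exists_eq_snakeZMk (p : (snakeZ α β).apex) : ∃ b a h, p = snakeZMk b a h := by
  obtain ⟨⟨⟨b, x⟩, ⟨y, a⟩⟩, h⟩ := p
  obtain rfl : (β.right b).1 = y := congrArg Prod.fst h
  obtain rfl : x = (α.left a).2 := congrArg (fun q => q.2.2) h
  exact ⟨b, a, congrArg (fun q => q.2.1) h, rfl⟩

theorem exists_eq_snakeNMk (p : (snakeN α β).apex) : ∃ a b h, p = snakeNMk a b h := by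
  obtain ⟨⟨⟨x, b⟩, ⟨a, y⟩⟩, h⟩ := p
  obtain rfl : x = (α.left a).1 := congrArg (fun q => q.1.1) h
  obtain rfl : (β.right b).2 = y := congrArg Prod.snd h
  exact ⟨a, b, (congrArg (fun q => q.1.2) h).symm, rfl⟩

/-- The copairing with the same apex as `α` and with its legs exchanged. -/
def flip (α : SetSpan (X × X) PUnit.{u + 1}) : SetSpan PUnit.{u + 1} (X × X) where
  apex := α.apex
  left _ := PUnit.unit
  right a := (α.left a).swap

theorem nonempty_iso_snakeZ_flip (h₁ : Function.Injective fun a => (α.left a).1)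
    (h₂ : Function.Bijective fun a => (α.left a).2) :
    Nonempty (Iso (snakeZ α α.flip) (id X)) := by
  refine nonempty_iso_id_iff.2 ⟨funext fun p => ?_, fun p p' e => ?_, fun x => ?_⟩
  · obtain ⟨b, a, h, rfl⟩ := exists_eq_snakeZMk p
    obtain rfl : b = a := h₁ h
    rfl
  · obtain ⟨b, a, h, rfl⟩ := exists_eq_snakeZMk p
    obtain ⟨b', a', h', rfl⟩ := exists_eq_snakeZMk p'
    obtain rfl : b = a := h₁ h
    obtain rfl : b' = a' := h₁ h'
    obtain rfl : b = b' := h₂.1 e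
    rfl
  · obtain ⟨a, rfl⟩ := h₂.2 x
    exact ⟨snakeZMk (β := α.flip) a a rfl, rfl⟩

theorem nonempty_iso_snakeN_flip (h₁ : Function.Bijective fun a => (α.left a).1)
    (h₂ : Function.Injective fun a => (α.left a).2) :
    Nonempty (Iso (snakeN α α.flip) (id X)) := by
  refine nonempty_iso_id_iff.2 ⟨funext fun p => ?_, fun p p' e => ?_, fun x => ?_⟩
  · obtain ⟨a, b, h, rfl⟩ := exists_eq_snakeNMk p
    obtain rfl : a = b := h₂ h
    rfl
  · obtain ⟨a, b, h, rfl⟩ := exists_eq_snakeNMk p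
    obtain ⟨a', b', h', rfl⟩ := exists_eq_snakeNMk p'
    obtain rfl : a = b := h₂ h
    obtain rfl : a' = b' := h₂ h'
    obtain rfl : a = a' := h₁.1 e
    rfl
  · obtain ⟨a, rfl⟩ := h₁.2 x
    exact ⟨snakeNMk (β := α.flip) a a rfl, rfl⟩

theorem eq_of_pairingZigzag_eq {z : Iso (snakeZ α β) (id X)} {n : Iso (snakeN α β) (id X)}
    (h : pairingZigzagN n = pairingZigzagZ z) {a a' : α.apex} {b : β.apex}
    (hab : (α.left a).2 = (β.right b).1) (hba : (β.right b).2 = (α.left a').1) : a = a' :=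
  (congrArg (fun f => f.toFun ⟨(a, b, a'), hab, hba⟩) h).symm

theorem biexact_iff :
    Biexact α ↔ Function.Bijective (fun a => (α.left a).1) ∧
      Function.Bijective (fun a => (α.left a).2) := by
  constructor
  · rintro ⟨β, z, n, hα, -⟩
    have surjZ (x : X) : ∃ b a, (β.right b).2 = (α.left a).1 ∧ (α.left a).2 = x := by
      obtain ⟨p, hp⟩ := (nonempty_iso_id_iff.1 ⟨z⟩).2.2 x
      obtain ⟨b, a, h, rfl⟩ := exists_eq_snakeZMk p
      exact ⟨b, a, h, hp⟩
    have surjN (x : X) : ∃ a b, (α.left a).2 = (β.right b).1 ∧ (α.left a).1 = x := by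
      obtain ⟨p, hp⟩ := (nonempty_iso_id_iff.1 ⟨n⟩).2.2 x
      obtain ⟨a, b, h, rfl⟩ := exists_eq_snakeNMk p
      exact ⟨a, b, h, hp⟩
    refine ⟨⟨fun a a' e => ?_, fun x => ?_⟩, ⟨fun a a' e => ?_, fun x => ?_⟩⟩
    · obtain ⟨c, b, h, hx⟩ := surjN (α.left a).1
      have hb : (β.right b).2 = (α.left a).1 := (snakeN_legs n c b h).symm.trans hx
      exact (eq_of_pairingZigzag_eq hα h hb).symm.trans
        (eq_of_pairingZigzag_eq hα h (hb.trans e))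
    · obtain ⟨a, b, -, hx⟩ := surjN x
      exact ⟨a, hx⟩
    · obtain ⟨b, c, h, hx⟩ := surjZ (α.left a).2
      have hb : (α.left a).2 = (β.right b).1 := hx.symm.trans (snakeZ_legs z b c h).symm
      exact (eq_of_pairingZigzag_eq hα hb h).trans
        (eq_of_pairingZigzag_eq hα (e.symm.trans hb) h).symm
    · obtain ⟨b, a, -, hx⟩ := surjZ x
      exact ⟨a, hx⟩
  · rintro ⟨h₁, h₂⟩
    obtain ⟨z⟩ := nonempty_iso_snakeZ_flip h₁.1 h₂
    obtain ⟨n⟩ := nonempty_iso_snakeN_flip h₁ h₂.1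
    refine ⟨α.flip, z, n, Hom.ext (funext ?_), Hom.ext (funext ?_)⟩
    · rintro ⟨⟨a, b, a'⟩, h, h'⟩
      exact ((h₂.1 h).trans (h₁.1 h')).symm
    · rintro ⟨⟨b, a, b'⟩, h, h'⟩
      exact (h₁.1 h).trans (h₂.1 h')

end Biexact

end SetSpan

namespace SSet.ParacyclicStructure

variable {X : SSet.{u}}

theorem δ_zero_τ_σ_zero (P : X.ParacyclicStructure) (n : ℕ) (x : X _⦋n⦌) :
    X.δ 0 (P.τ (n + 1) (X.σ 0 x)) = P.τ n x :=
  (P.δ_τ n 0 _).trans (congrArg (P.τ n) (X.δ_comp_σ_succ_apply 0 x))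

/-- The system of extra degeneracies `τⁿ⁺¹ s₀` of a paracyclic structure. -/
def toExtraDegeneracies (P : X.ParacyclicStructure) : X.ExtraDegeneracies where
  s n x := P.τ (n + 1) (X.σ 0 x)
  δ_s n i x := by
    rw [P.δ_τ]
    exact congrArg (P.τ (n + 1))
      (X.δ_comp_σ_of_gt_apply (i := i.succ) (j := 0) (Fin.succ_pos i) x)
  δ_last_s n x := (P.δ_last_τ n _).trans (X.δ_comp_σ_self_apply 0 x)
  σ_s n i x := by
    rw [P.σ_τ]
    exact congrArg (P.τ (n + 2)) (X.σ_comp_σ_apply (Fin.zero_le i) x).symm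
  σ_last_s n x := by
    rw [P.σ_last_τ]
    exact congrArg (P.τ (n + 2)) ((congrArg (P.τ (n + 2))
      (X.σ_comp_σ_apply (le_refl (0 : Fin (n + 1))) x)).trans (P.σ_τ (n + 1) 0 (X.σ 0 x)).symm)
  bijective n := by
    rw [funext (P.δ_zero_τ_σ_zero n)]
    exact (P.τ n).bijective

end SSet.ParacyclicStructure

namespace SSet.ExtraDegeneracies

variable {X : SSet.{u}}

theorem δ_zero_s_σ_zero (D : X.ExtraDegeneracies) (n : ℕ) (x : X _⦋n⦌) :
    X.δ 0 (D.s (n + 1) (X.σ 0 x)) = D.s n x := by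
  rw [← D.σ_s n 0 x]
  exact X.δ_comp_σ_self_apply 0 _

/-- The paracyclic structure `d₀ sⁿₙ₊₁` of a system of extra degeneracies. -/
noncomputable def toParacyclicStructure (D : X.ExtraDegeneracies) : X.ParacyclicStructure where
  τ n := Equiv.ofBijective _ (D.bijective n)
  δ_τ n i x := by
    change X.δ i.castSucc (X.δ 0 (D.s (n + 1) x)) = X.δ 0 (D.s n (X.δ i.succ x))
    rw [← D.δ_s n i x]
    exact (X.δ_comp_δ_apply (Fin.zero_le i.castSucc) _).symm
  δ_last_τ n x :=
    (X.δ_comp_δ_apply (Fin.zero_le (Fin.last (n + 1))) _).symm.trans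
      (congrArg (X.δ 0) (D.δ_last_s (n + 1) x))
  σ_τ n i x := by
    change X.σ i.castSucc (X.δ 0 (D.s n x)) = X.δ 0 (D.s (n + 1) (X.σ i.succ x))
    rw [← D.σ_s n i.succ x]
    exact (X.δ_comp_σ_of_le_apply (i := 0) (Fin.zero_le i.castSucc.castSucc) _).symm
  σ_last_τ n x := by
    change X.σ (Fin.last n) (X.δ 0 (D.s n x)) =
      X.δ 0 (D.s (n + 1) (X.δ 0 (D.s (n + 1) (X.σ 0 x))))
    rw [D.δ_zero_s_σ_zero, ← D.σ_last_s n x]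
    exact (X.δ_comp_σ_of_le_apply (i := 0) (Fin.zero_le (Fin.last n).castSucc) _).symm

end SSet.ExtraDegeneracies

/-- Paracyclic structures are the same as systems of extra degeneracies. -/
noncomputable def SSet.ParacyclicStructure.equivExtraDegeneracies {X : SSet.{u}} :
    X.ParacyclicStructure ≃ X.ExtraDegeneracies where
  toFun P := P.toExtraDegeneracies
  invFun D := D.toParacyclicStructure
  left_inv P := ParacyclicStructure.ext (funext fun n => Equiv.ext (P.δ_zero_τ_σ_zero n))
  right_inv D := ExtraDegeneracies.ext (funext fun n => funext (D.δ_zero_s_σ_zero n))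

namespace PolygonTriangulation

variable {n : ℕ}

/-- The face inclusion `⦋2⦌ ⟶ ⦋n⦌` of a triangle of a triangulation. -/
def Triangle.hom {T : PolygonTriangulation n} (t : T.Triangle) : ⦋2⦌ ⟶ ⦋n⦌ :=
  SimplexCategory.mkHom t.1.toOrderHom

instance {T : PolygonTriangulation n} (t : T.Triangle) : Mono t.hom :=
  SimplexCategory.mono_iff_injective.2 t.1.injective

/-- The triangle with vertices `a < b < c`, all of whose sides are chords. -/
def triangleOfMem {T : PolygonTriangulation n} {a b c : Fin (n + 1)} (hab : (a, b) ∈ T.chords)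
    (hbc : (b, c) ∈ T.chords) (hac : (a, c) ∈ T.chords) : T.Triangle :=
  ⟨OrderEmbedding.ofStrictMono ![a, b, c] (Fin.strictMono_iff_lt_succ.2
      (Fin.forall_fin_two.2 ⟨T.lt_of_mem _ hab, T.lt_of_mem _ hbc⟩)), by
    intro i j hij
    fin_cases i <;> fin_cases j <;>
      first
      | exact absurd hij (by decide)
      | assumption⟩

theorem eq_triangleOfMem {T : PolygonTriangulation n} {a b c : Fin (n + 1)}
    {hab : (a, b) ∈ T.chords} {hbc : (b, c) ∈ T.chords} {hac : (a, c) ∈ T.chords}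
    {t : T.Triangle} (h0 : t.1 0 = a) (h1 : t.1 1 = b) (h2 : t.1 2 = c) :
    t = triangleOfMem hab hbc hac :=
  Subtype.ext (DFunLike.ext _ _ (Fin.forall_fin_succ.2 ⟨h0, Fin.forall_fin_two.2 ⟨h1, h2⟩⟩))

theorem exists_hom_eq_comp {m : ℕ} {T : PolygonTriangulation n} {T' : PolygonTriangulation m}
    (f : ⦋n⦌ ⟶ ⦋m⦌) (hf : ∀ c ∈ T.chords, (f c.1, f c.2) ∈ T'.chords) (t : T.Triangle) :
    ∃ t' : T'.Triangle, t'.hom = t.hom ≫ f :=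
  have hchord (i j : Fin 3) (hij : i < j) : (f (t.1 i), f (t.1 j)) ∈ T'.chords :=
    hf _ (t.2 i j hij)
  ⟨⟨OrderEmbedding.ofStrictMono (fun i => f (t.1 i))
    fun _ _ hij => T'.lt_of_mem _ (hchord _ _ hij), hchord⟩, rfl⟩

/-- The triangulation with all diagonals through the vertex `v`. -/
def fan (n : ℕ) (v : Fin (n + 1)) : PolygonTriangulation n where
  chords := {c | c.1 < c.2 ∧
    (c.1 = v ∨ c.2 = v ∨ c.2.val = c.1.val + 1 ∨ c = (0, Fin.last n))}
  lt_of_mem _ h := h.1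
  noncrossing := by
    rintro ⟨a, b⟩ ⟨h1, h2⟩ ⟨c, d⟩ ⟨h3, h4⟩ h
    simp only [ChordsCross, Prod.ext_iff, Fin.lt_def, Fin.ext_iff, Fin.val_zero,
      Fin.val_last] at *
    omega
  maximal := by
    rintro ⟨a, b⟩ h h'
    by_contra hc
    -- A pair `(a, b)` that is not a chord is crossed by a diagonal from `v` to its other side.
    obtain ⟨p, q, hpq, hq, hv, hcross⟩ : ∃ p q : ℕ, p < q ∧ q < n + 1 ∧ (p = v ∨ q = v) ∧
        ((a < p ∧ p < b ∧ b < q) ∨ (p < a ∧ a < q ∧ q < b)) := by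
      simp only [Set.mem_ofPred_eq, Prod.ext_iff, Fin.lt_def, Fin.ext_iff, Fin.val_zero,
        Fin.val_last] at h hc
      obtain hv | hv | hv | hv : v.val < a ∨ b.val < v ∨ (a.val < v ∧ v.val < b ∧ 0 < a.val) ∨
          (a.val < v ∧ v.val < b ∧ b.val < n) := by omega
      · exact ⟨v, a + 1, by omega⟩
      · exact ⟨a + 1, v, by omega⟩
      · exact ⟨0, v, by omega⟩
      · exact ⟨v, n, by omega⟩
    exact h' (⟨p, hpq.trans hq⟩, ⟨q, hq⟩)
      ⟨hpq, by simpa only [Fin.ext_iff, or_assoc] using Or.inl hv⟩ hcross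

theorem mem_chords_fan {v a b : Fin (n + 1)} : (a, b) ∈ (fan n v).chords ↔
    a.val < b ∧ (a.val = v ∨ b.val = v ∨ b.val = a + 1 ∨ (a.val = 0 ∧ b.val = n)) := by
  simp only [fan, Set.mem_ofPred_eq, Prod.ext_iff, Fin.lt_def, Fin.ext_iff, Fin.val_zero,
    Fin.val_last]

end PolygonTriangulation

open PolygonTriangulation

namespace SSet.IsTwoSegal

variable {X : SSet.{u}}

theorem existsUnique_amalgamation (hX : X.IsTwoSegal) {n : ℕ} (hn : 2 ≤ n)
    {T : PolygonTriangulation n} {ι : Type*} {m : ι → ℕ} (hm : ∀ a, 2 ≤ m a)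
    {T' : ∀ a, PolygonTriangulation (m a)} {f : ∀ a, ⦋m a⦌ ⟶ ⦋n⦌}
    (hf : ∀ a, ∀ c ∈ (T' a).chords, (f a c.1, f a c.2) ∈ T.chords)
    (hT : ∀ t : T.Triangle, ∃ (a : ι) (g : ⦋2⦌ ⟶ ⦋m a⦌), g ≫ f a = t.hom)
    {x : ∀ a, X _⦋m a⦌} (hx : Presieve.Arrows.Compatible X f x) :
    ∃! ψ : X _⦋n⦌, ∀ a, X.map (f a).op ψ = x a := by
  choose a g hg using hT
  let ξ : X.TriangulationLimit T := ⟨fun t => X.map (g t).op (x (a t)), fun t t' i j h => by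
    have hedge : SimplexCategory.δ i ≫ t.hom = SimplexCategory.δ j ≫ t'.hom := by
      ext k
      exact congrArg Fin.val (DFunLike.congr_fun h k)
    have hcomp := hx _ _ _ (SimplexCategory.δ i ≫ g t) (SimplexCategory.δ j ≫ g t')
      (by rw [Category.assoc, Category.assoc, hg, hg, hedge])
    rwa [op_comp, op_comp, Functor.map_comp_apply, Functor.map_comp_apply] at hcomp⟩
  obtain ⟨ψ, hψ⟩ := (hX n hn T).surjective ξ
  have hψ (t : T.Triangle) : X.map t.hom.op ψ = X.map (g t).op (x (a t)) :=
    congrArg (fun ζ => ζ.1 t) hψ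
  refine ⟨ψ, fun b => (hX _ (hm b) (T' b)).injective (Subtype.ext (funext fun t => ?_)),
    fun ψ' hψ' => (hX n hn T).injective (Subtype.ext (funext fun t => ?_))⟩
  · obtain ⟨t', ht'⟩ := exists_hom_eq_comp (f b) (hf b) t
    change X.map t.hom.op (X.map (f b).op ψ) = X.map t.hom.op (x b)
    rw [← Functor.map_comp_apply, ← op_comp, ← ht', hψ]
    exact hx _ _ _ _ _ ((hg t').trans ht')
  · change X.map t.hom.op ψ' = X.map t.hom.op ψ
    rw [hψ, ← hψ', ← hg t, op_comp, Functor.map_comp_apply]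

end SSet.IsTwoSegal

namespace PolygonTriangulation

/-- An ear of the triangulation `T`: a triangle whose vertex number `k` is the vertex `j` of the
polygon, belongs to no other triangle, and is adjacent to a polygon triangulated by `T'` along its
side from the first to the last vertex. -/
structure Ear {n : ℕ} (T' : PolygonTriangulation n) (T : PolygonTriangulation (n + 1))
    (j : Fin (n + 2)) (k : Fin 3) where
  /-- the triangle -/
  triangle : T.Triangle
  apply_eq : triangle.1 k = j
  δ_comp_hom : SimplexCategory.δ k ≫ triangle.hom = SimplexCategory.diag n ≫ SimplexCategory.δ j
  succAbove_mem : ∀ c ∈ T'.chords, (j.succAbove c.1, j.succAbove c.2) ∈ T.chords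
  eq_of_apply_eq : ∀ (t : T.Triangle) (i : Fin 3), t.1 i = j → t = triangle

theorem Ear.exists_eq_comp {n : ℕ} {T' : PolygonTriangulation n}
    {T : PolygonTriangulation (n + 1)} {j : Fin (n + 2)} {k : Fin 3} (t : T'.Ear T j k)
    {Z : SimplexCategory} {u : Z ⟶ ⦋n⦌} {v : Z ⟶ ⦋2⦌}
    (h : u ≫ SimplexCategory.δ j = v ≫ t.triangle.hom) :
    ∃ w : Z ⟶ ⦋1⦌, v = w ≫ SimplexCategory.δ k ∧ u = w ≫ SimplexCategory.diag n := by
  have hv (i) : v i ≠ k := fun hi => by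
    refine Fin.succAbove_ne j (u i) ((ConcreteCategory.congr_hom h i).trans ?_)
    exact (congrArg t.triangle.1 hi).trans t.apply_eq
  obtain ⟨w, rfl⟩ := SimplexCategory.eq_comp_δ_of_not_surjective' v k hv
  refine ⟨w, rfl, (cancel_mono (SimplexCategory.δ j)).1 ?_⟩
  rw [h, Category.assoc, Category.assoc, t.δ_comp_hom]

end PolygonTriangulation

namespace SSet.IsTwoSegal

variable {X : SSet.{u}}

theorem existsUnique_ear (hX : X.IsTwoSegal) {n : ℕ} (hn : 2 ≤ n) {T' : PolygonTriangulation n}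
    {T : PolygonTriangulation (n + 1)} {j : Fin (n + 2)} {k : Fin 3} (t : T'.Ear T j k)
    {x : X _⦋n⦌} {ξ : X _⦋2⦌} (h : X.δ k ξ = X.diagonal x) :
    ∃! ψ : X _⦋n + 1⦌, X.δ j ψ = x ∧ X.map t.triangle.hom.op ψ = ξ := by
  -- The index `false` stands for the ear and `true` for the remaining polygon.
  let m : Bool → ℕ := fun b => b.casesOn 2 n
  let S : ∀ b, PolygonTriangulation (m b) := fun b => b.casesOn (fan 2 0) T'
  let f : ∀ b, ⦋m b⦌ ⟶ ⦋n + 1⦌ := fun b => b.casesOn t.triangle.hom (SimplexCategory.δ j)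
  let y : ∀ b, X _⦋m b⦌ := fun b => b.casesOn ξ x
  have hm : ∀ b, 2 ≤ m b := Bool.forall_bool.2 ⟨le_refl 2, hn⟩
  have hf : ∀ b, ∀ c ∈ (S b).chords, (f b c.1, f b c.2) ∈ T.chords :=
    Bool.forall_bool.2 ⟨fun c hc => t.triangle.2 _ _ ((fan 2 0).lt_of_mem c hc), t.succAbove_mem⟩
  have hT (t' : T.Triangle) : ∃ (b : Bool) (g : ⦋2⦌ ⟶ ⦋m b⦌), g ≫ f b = t'.hom := by
    by_cases h' : ∃ i, t'.1 i = j
    · obtain ⟨i, hi⟩ := h'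
      exact ⟨false, 𝟙 _, by rw [t.eq_of_apply_eq t' i hi]; exact Category.id_comp _⟩
    · obtain ⟨g, hg⟩ := SimplexCategory.eq_comp_δ_of_not_surjective' t'.hom j (not_exists.1 h')
      exact ⟨true, g, hg.symm⟩
  have hmixed {Z : SimplexCategory} (u : Z ⟶ ⦋n⦌) (v : Z ⟶ ⦋2⦌)
      (huv : u ≫ SimplexCategory.δ j = v ≫ t.triangle.hom) :
      X.map u.op x = X.map v.op ξ := by
    obtain ⟨w, rfl, rfl⟩ := t.exists_eq_comp huv
    rw [op_comp, op_comp, Functor.map_comp_apply, Functor.map_comp_apply]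
    exact congrArg (X.map w.op) h.symm
  have hy : Presieve.Arrows.Compatible X f y := by
    rintro (_ | _) (_ | _) Z u v huv
    · rw [(cancel_mono t.triangle.hom).1 huv]
    · exact (hmixed v u huv.symm).symm
    · exact hmixed u v huv
    · rw [(cancel_mono (SimplexCategory.δ j)).1 huv]
  exact (existsUnique_congr fun ψ => Bool.forall_bool' true).1
    (hX.existsUnique_amalgamation (by omega) hm hf hT hy)

end SSet.IsTwoSegal

namespace PolygonTriangulation

/-- The ear `0, n, n + 1` of the fan at the vertex `0`. -/
def fanZeroEar {n : ℕ} (hn : 1 ≤ n) : (fan n 0).Ear (fan (n + 1) 0) (Fin.last (n + 1)) 2 where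
  triangle := triangleOfMem (a := 0) (b := (Fin.last n).castSucc) (c := Fin.last (n + 1))
    (mem_chords_fan.2 (by simp; omega)) (mem_chords_fan.2 (by simp))
    (mem_chords_fan.2 (by simp))
  apply_eq := rfl
  δ_comp_hom := by
    ext i
    fin_cases i
    · exact congrArg Fin.val (Fin.succAbove_last_apply (0 : Fin (n + 1))).symm
    · exact congrArg Fin.val (Fin.succAbove_last_apply (Fin.last n)).symm
  succAbove_mem := by
    rintro ⟨a, b⟩ h
    rw [mem_chords_fan] at h ⊢
    simp only [Fin.succAbove_last, Fin.val_castSucc, Fin.val_zero] at h ⊢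
    omega
  eq_of_apply_eq t i hi := by
    have h2 : t.1 2 = Fin.last (n + 1) :=
      Fin.last_le_iff.1 (hi ▸ t.1.monotone (Fin.le_last i))
    have h01 := mem_chords_fan.1 (t.2 0 1 (by decide))
    have h12 := mem_chords_fan.1 (t.2 1 2 (by decide))
    have h02 := mem_chords_fan.1 (t.2 0 2 (by decide))
    simp only [h2, Fin.val_zero, Fin.val_last] at h01 h12 h02
    exact eq_triangleOfMem (Fin.ext (by simp only [Fin.val_zero]; omega))
      (Fin.ext (by simp only [Fin.val_castSucc, Fin.val_last]; omega)) h2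

/-- The ear `0, 1, n + 1` of the fan at the last vertex. -/
def fanLastEar {n : ℕ} (hn : 1 ≤ n) :
    (fan n (Fin.last n)).Ear (fan (n + 1) (Fin.last (n + 1))) 0 0 where
  triangle := triangleOfMem (a := 0) (b := 1) (c := Fin.last (n + 1))
    (mem_chords_fan.2 (by simp)) (mem_chords_fan.2 (by simp; omega))
    (mem_chords_fan.2 (by simp))
  apply_eq := rfl
  δ_comp_hom := by
    ext i
    fin_cases i <;> rfl
  succAbove_mem := by
    rintro ⟨a, b⟩ h
    rw [mem_chords_fan] at h ⊢
    simp only [Fin.succAbove_zero, Fin.val_succ, Fin.val_last] at h ⊢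
    omega
  eq_of_apply_eq t i hi := by
    have h0 : t.1 0 = 0 := Fin.le_zero_iff.1 (hi ▸ t.1.monotone (Fin.zero_le i))
    have h01 := mem_chords_fan.1 (t.2 0 1 (by decide))
    have h12 := mem_chords_fan.1 (t.2 1 2 (by decide))
    have h02 := mem_chords_fan.1 (t.2 0 2 (by decide))
    simp only [h0, Fin.val_zero, Fin.val_last] at h01 h12 h02
    exact eq_triangleOfMem h0 (Fin.ext (by simp only [Fin.val_one]; omega))
      (Fin.ext (by simp only [Fin.val_last]; omega))

end PolygonTriangulation

section Diagonal

variable {X : SSet.{u}}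

theorem diagonal_edge (x : X _⦋1⦌) : X.diagonal x = x := by
  have h : SimplexCategory.diag 1 = 𝟙 _ := by
    ext i
    fin_cases i <;> rfl
  rw [SimplicialObject.diagonal, h, op_id, Functor.map_id_apply]

theorem diagonal_δ {n : ℕ} (i : Fin n) (ψ : X _⦋n + 1⦌) :
    X.diagonal (X.δ i.castSucc.succ ψ) = X.diagonal ψ := by
  have h : SimplexCategory.diag n ≫ SimplexCategory.δ i.castSucc.succ =
      SimplexCategory.diag (n + 1) := by
    ext k
    fin_cases k
    · exact congrArg Fin.val (Fin.succ_succAbove_zero i.castSucc)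
    · refine congrArg Fin.val (Fin.succAbove_of_le_castSucc _ (Fin.last n) ?_)
      rw [Fin.succ_castSucc]
      exact Fin.castSucc_le_castSucc_iff.2 (Fin.le_last _)
  rw [SimplicialObject.diagonal, SimplicialObject.diagonal, SimplicialObject.δ_def, ← h, op_comp,
    Functor.map_comp_apply]

theorem diagonal_triangle (ξ : X _⦋2⦌) : X.diagonal ξ = X.δ 1 ξ :=
  (diagonal_δ (0 : Fin 1) ξ).symm.trans (diagonal_edge _)

theorem diagonal_σ {n : ℕ} (i : Fin (n + 1)) (ψ : X _⦋n⦌) :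
    X.diagonal (X.σ i ψ) = X.diagonal ψ := by
  have h : SimplexCategory.diag (n + 1) ≫ SimplexCategory.σ i = SimplexCategory.diag n := by
    ext k
    fin_cases k
    · exact congrArg Fin.val (Fin.predAbove_right_zero (i := i))
    · exact congrArg Fin.val (Fin.predAbove_right_last (i := i))
  rw [SimplicialObject.diagonal, SimplicialObject.diagonal, SimplicialObject.σ_def, ← h, op_comp,
    Functor.map_comp_apply]

end Diagonal

namespace SSet.IsTwoSegal

variable {X : SSet.{u}}

theorem existsUnique_diagonal_mem (hX : X.IsTwoSegal) {n : ℕ} (hn : 2 ≤ n)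
    {T' : PolygonTriangulation n} {T : PolygonTriangulation (n + 1)} {j : Fin (n + 2)} {k : Fin 3}
    (t : T'.Ear T j k)
    (ht : SimplexCategory.δ 1 ≫ t.triangle.hom = SimplexCategory.diag (n + 1))
    {E : Set (X _⦋1⦌)} (hE : ∀ y, ∃! ξ, X.δ k ξ = y ∧ X.δ 1 ξ ∈ E) (x : X _⦋n⦌) :
    ∃! ψ, X.δ j ψ = x ∧ X.diagonal ψ ∈ E := by
  have δ_k (ψ : X _⦋n + 1⦌) : X.δ k (X.map t.triangle.hom.op ψ) = X.diagonal (X.δ j ψ) := by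
    simp only [SimplicialObject.diagonal, SimplicialObject.δ_def, ← Functor.map_comp_apply,
      ← op_comp, t.δ_comp_hom]
  have δ_one (ψ : X _⦋n + 1⦌) : X.δ 1 (X.map t.triangle.hom.op ψ) = X.diagonal ψ := by
    simp only [SimplicialObject.diagonal, SimplicialObject.δ_def, ← Functor.map_comp_apply,
      ← op_comp, ht]
  obtain ⟨ξ, ⟨hξ, hξE⟩, hξu⟩ := hE (X.diagonal x)
  obtain ⟨ψ, ⟨hψ, rfl⟩, hψu⟩ := hX.existsUnique_ear hn t hξ
  refine ⟨ψ, ⟨hψ, δ_one ψ ▸ hξE⟩, fun φ ⟨hφ, hφE⟩ => hψu φ ⟨hφ, hξu _ ⟨?_, ?_⟩⟩⟩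
  · rw [δ_k, hφ]
  · rwa [δ_one]

end SSet.IsTwoSegal

/-- A set `E` of edges such that every edge is the first edge, and also the last edge, of a unique
triangle with long edge in `E`. These are the images of the counits of Frobenius structures. -/
structure IsCounitSet {X : SSet.{u}} (E : Set (X _⦋1⦌)) : Prop where
  existsUnique_δ_two : ∀ x, ∃! ξ, X.δ 2 ξ = x ∧ X.δ 1 ξ ∈ E
  existsUnique_δ_zero : ∀ x, ∃! ξ, X.δ 0 ξ = x ∧ X.δ 1 ξ ∈ E

namespace IsCounitSet

variable {X : SSet.{u}} {E : Set (X _⦋1⦌)}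

theorem existsUnique_source (hE : IsCounitSet E) (v : X _⦋0⦌) : ∃! e, X.δ 1 e = v ∧ e ∈ E := by
  obtain ⟨ξ, ⟨hξ, hξE⟩, hu⟩ := hE.existsUnique_δ_two (X.σ 0 v)
  refine ⟨X.δ 1 ξ, ⟨?_, hξE⟩, ?_⟩
  · calc X.δ 1 (X.δ 1 ξ) = X.δ 1 (X.δ 2 ξ) := (X.δ_comp_δ_apply (i := 1) (j := 1) le_rfl ξ).symm
      _ = v := by rw [hξ]; exact X.δ_comp_σ_succ_apply 0 v
  · rintro e ⟨rfl, he⟩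
    have hσ : X.δ 1 (X.σ 0 e) = e := X.δ_comp_σ_succ_apply 0 e
    rw [← hu (X.σ 0 e) ⟨X.δ_comp_σ_of_gt_apply (i := 1) (j := 0) (by decide) e, hσ.symm ▸ he⟩,
      hσ]

theorem existsUnique_target (hE : IsCounitSet E) (v : X _⦋0⦌) : ∃! e, X.δ 0 e = v ∧ e ∈ E := by
  obtain ⟨ξ, ⟨hξ, hξE⟩, hu⟩ := hE.existsUnique_δ_zero (X.σ 0 v)
  refine ⟨X.δ 1 ξ, ⟨?_, hξE⟩, ?_⟩
  · calc X.δ 0 (X.δ 1 ξ) = X.δ 0 (X.δ 0 ξ) := X.δ_comp_δ_apply (i := 0) (j := 0) le_rfl ξ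
      _ = v := by rw [hξ]; exact X.δ_comp_σ_self_apply 0 v
  · rintro e ⟨rfl, he⟩
    have hσ : X.δ 1 (X.σ 1 e) = e := X.δ_comp_σ_self_apply 1 e
    rw [← hu (X.σ 1 e) ⟨X.δ_comp_σ_of_le_apply (i := 0) (j := 0) le_rfl e, hσ.symm ▸ he⟩, hσ]

theorem existsUnique_last (hE : IsCounitSet E) (hX : X.IsTwoSegal) {n : ℕ} (x : X _⦋n⦌) :
    ∃! ψ, X.δ (Fin.last (n + 1)) ψ = x ∧ X.diagonal ψ ∈ E :=
  match n, x with
  | 0, x => by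
    simp only [diagonal_edge (X := X)]
    exact hE.existsUnique_source x
  | 1, x => by
    simp only [diagonal_triangle (X := X)]
    exact hE.existsUnique_δ_two x
  | _ + 2, x => hX.existsUnique_diagonal_mem (Nat.le_add_left ..) (fanZeroEar (by omega))
      (by ext i; fin_cases i <;> rfl) hE.existsUnique_δ_two x

theorem existsUnique_zero (hE : IsCounitSet E) (hX : X.IsTwoSegal) {n : ℕ} (x : X _⦋n⦌) :
    ∃! ψ, X.δ 0 ψ = x ∧ X.diagonal ψ ∈ E :=
  match n, x with
  | 0, x => by
    simp only [diagonal_edge (X := X)]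
    exact hE.existsUnique_target x
  | 1, x => by
    simp only [diagonal_triangle (X := X)]
    exact hE.existsUnique_δ_zero x
  | _ + 2, x => hX.existsUnique_diagonal_mem (Nat.le_add_left ..) (fanLastEar (by omega))
      (by ext i; fin_cases i <;> rfl) hE.existsUnique_δ_zero x

/-- The unique simplex with last face `x` and diagonal in `E`; it is the value at `x` of the system
of extra degeneracies corresponding to `E`. -/
noncomputable def filler (hE : IsCounitSet E) (hX : X.IsTwoSegal) {n : ℕ} (x : X _⦋n⦌) :
    X _⦋n + 1⦌ :=
  (hE.existsUnique_last hX x).choose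

variable (hE : IsCounitSet E) (hX : X.IsTwoSegal) {n : ℕ}

theorem δ_last_filler (x : X _⦋n⦌) : X.δ (Fin.last (n + 1)) (hE.filler hX x) = x :=
  (hE.existsUnique_last hX x).choose_spec.1.1

theorem diagonal_filler_mem (x : X _⦋n⦌) : X.diagonal (hE.filler hX x) ∈ E :=
  (hE.existsUnique_last hX x).choose_spec.1.2

theorem eq_filler {x : X _⦋n⦌} {ψ : X _⦋n + 1⦌} (h : X.δ (Fin.last (n + 1)) ψ = x)
    (h' : X.diagonal ψ ∈ E) : ψ = hE.filler hX x :=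
  (hE.existsUnique_last hX x).choose_spec.2 ψ ⟨h, h'⟩

end IsCounitSet

namespace IsCounitSet

variable {X : SSet.{u}} {E : Set (X _⦋1⦌)}

/-- The system of extra degeneracies whose values are the simplices with diagonal in `E`. -/
noncomputable def extraDegeneracies (hE : IsCounitSet E) (hX : X.IsTwoSegal) :
    X.ExtraDegeneracies where
  s _ := hE.filler hX
  δ_s n i x := by
    refine hE.eq_filler hX ?_ ?_
    · exact (X.δ_comp_δ_apply (Fin.le_last i.succ) _).symm.trans
        (congrArg (X.δ i.succ) (hE.δ_last_filler hX x))
    · rw [← Fin.succ_castSucc, diagonal_δ]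
      exact hE.diagonal_filler_mem hX x
  δ_last_s _ := hE.δ_last_filler hX
  σ_s n i x := by
    refine hE.eq_filler hX ?_ ?_
    · exact (X.δ_comp_σ_of_gt_apply (Fin.castSucc_lt_last i) _).trans
        (congrArg (X.σ i) (hE.δ_last_filler hX x))
    · rw [diagonal_σ]
      exact hE.diagonal_filler_mem hX x
  σ_last_s n x := by
    refine hE.eq_filler hX (X.δ_comp_σ_succ_apply (Fin.last (n + 1)) _) ?_
    rw [diagonal_σ]
    exact hE.diagonal_filler_mem hX x
  bijective n := by
    refine ⟨fun x y h => ?_, fun x => ?_⟩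
    · have e : hE.filler hX x = hE.filler hX y := (hE.existsUnique_zero hX _).unique
        ⟨h, hE.diagonal_filler_mem hX x⟩ ⟨rfl, hE.diagonal_filler_mem hX y⟩
      rw [← hE.δ_last_filler hX x, e, hE.δ_last_filler hX y]
    · obtain ⟨ψ, ⟨h, hψ⟩, -⟩ := hE.existsUnique_zero hX x
      exact ⟨X.δ (Fin.last (n + 1)) ψ,
        (congrArg (X.δ 0) (hE.eq_filler hX rfl hψ)).symm.trans h⟩

theorem range_extraDegeneracies_s_zero (hE : IsCounitSet E) (hX : X.IsTwoSegal) :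
    Set.range ((hE.extraDegeneracies hX).s 0) = E := by
  ext e
  refine ⟨?_, fun he => ⟨X.δ 1 e, (hE.eq_filler hX rfl ((diagonal_edge e).symm ▸ he)).symm⟩⟩
  rintro ⟨v, rfl⟩
  have h := hE.diagonal_filler_mem hX v
  rwa [diagonal_edge] at h

end IsCounitSet

theorem existsUnique_of_bijective_comp {A B C : Type*} {s : A → B} {d : B → C}
    (h : Function.Bijective fun a => d (s a)) (c : C) : ∃! b, d b = c ∧ b ∈ Set.range s := by
  obtain ⟨a, rfl⟩ := h.2 c
  refine ⟨s a, ⟨rfl, a, rfl⟩, ?_⟩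
  rintro _ ⟨hb, a', rfl⟩
  rw [h.1 hb]

namespace SSet.ExtraDegeneracies

variable {X : SSet.{u}} (D : X.ExtraDegeneracies)

theorem diagonal_s_mem {n : ℕ} (x : X _⦋n⦌) : X.diagonal (D.s n x) ∈ Set.range (D.s 0) := by
  induction n with
  | zero => exact ⟨x, (diagonal_edge (D.s 0 x)).symm⟩
  | succ n ih =>
    rw [← diagonal_δ 0, Fin.succ_castSucc, D.δ_s]
    exact ih _

theorem δ_one_mem_range_s_zero_iff (hX : X.IsTwoSegal) (ξ : X _⦋2⦌) :
    X.δ 1 ξ ∈ Set.range (D.s 0) ↔ ξ ∈ Set.range (D.s 1) := by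
  let P := D.toParacyclicStructure
  refine ⟨?_, ?_⟩
  · rintro ⟨v, hv⟩
    obtain ⟨ζ, rfl⟩ := (P.τ 2).surjective ξ
    have hζ : X.δ 2 ζ = X.σ 0 v := (P.τ 1).injective <|
      calc P.τ 1 (X.δ 2 ζ) = X.δ 1 (P.τ 2 ζ) := (P.δ_τ 1 1 ζ).symm
        _ = D.s 0 v := hv.symm
        _ = P.τ 1 (X.σ 0 v) := (D.δ_zero_s_σ_zero 0 v).symm
    exact ⟨X.δ 1 ζ, (D.δ_zero_s_σ_zero 1 _).symm.trans
      (congrArg (P.τ 2) (SSet.eq_σ_zero hX ζ v hζ)).symm⟩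
  · rintro ⟨x, rfl⟩
    exact ⟨X.δ 1 x, (D.δ_s 0 0 x).symm⟩

theorem isCounitSet_range_s_zero (hX : X.IsTwoSegal) : IsCounitSet (Set.range (D.s 0)) where
  existsUnique_δ_two x := by
    simp only [D.δ_one_mem_range_s_zero_iff hX]
    have h : (fun y => X.δ 2 (D.s 1 y)) = id := funext (D.δ_last_s 1)
    exact existsUnique_of_bijective_comp (d := X.δ 2) (h ▸ Function.bijective_id) x
  existsUnique_δ_zero x := by
    simp only [D.δ_one_mem_range_s_zero_iff hX]
    exact existsUnique_of_bijective_comp (d := X.δ 0) (D.bijective 1) x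

/-- Systems of extra degeneracies correspond to counit sets, namely to the image of their extra
degeneracy in degree `0`. -/
noncomputable def equivCounitSet (hX : X.IsTwoSegal) :
    X.ExtraDegeneracies ≃ {E : Set (X _⦋1⦌) // IsCounitSet E} where
  toFun D := ⟨Set.range (D.s 0), D.isCounitSet_range_s_zero hX⟩
  invFun E := E.2.extraDegeneracies hX
  left_inv D := ExtraDegeneracies.ext <| funext fun n => funext fun x =>
    ((D.isCounitSet_range_s_zero hX).eq_filler hX (D.δ_last_s n x) (D.diagonal_s_mem x)).symm
  right_inv E := Subtype.ext (E.2.range_extraDegeneracies_s_zero hX)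

end SSet.ExtraDegeneracies

section Pullback

variable {A B C T : Type*} {l : T → A} {m : B → A} {d : B → C}

theorem injective_of_injective_pullback (hm : m.Surjective)
    (h : Function.Injective fun p : {p : B × T // m p.1 = l p.2} => d p.1.1) : l.Injective := by
  intro t t' e
  obtain ⟨b, hb⟩ := hm (l t)
  have hp := h (a₁ := ⟨(b, t), hb⟩) (a₂ := ⟨(b, t'), hb.trans e⟩) rfl
  exact congrArg (fun p => p.1.2) hp

theorem bijective_pullback_iff (hl : l.Injective) :
    (Function.Bijective fun p : {p : B × T // m p.1 = l p.2} => d p.1.1) ↔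
      ∀ c, ∃! b, d b = c ∧ m b ∈ Set.range l := by
  refine (Function.bijective_iff_existsUnique _).trans (forall_congr' fun c => ⟨?_, ?_⟩)
  · rintro ⟨⟨⟨b, t⟩, hb⟩, hc, hu⟩
    refine ⟨b, ⟨hc, t, hb.symm⟩, ?_⟩
    rintro b' ⟨hc', t', ht'⟩
    exact congrArg (fun p => p.1.1) (hu ⟨(b', t'), ht'.symm⟩ hc')
  · rintro ⟨b, ⟨hc, t, ht⟩, hu⟩
    refine ⟨⟨(b, t), ht.symm⟩, hc, ?_⟩
    rintro ⟨⟨b', t'⟩, hb'⟩ hc'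
    obtain rfl : b' = b := hu b' ⟨hc', t', hb'.symm⟩
    obtain rfl : t' = t := hl (hb'.symm.trans ht.symm)
    rfl

end Pullback

section Frobenius

variable {X : SSet.{u}}

theorem biexact_mulSpan_comp_iff {ε : SetSpan (X _⦋1⦌) PUnit.{u + 1}} :
    SetSpan.Biexact (X.mulSpan.comp ε) ↔ ε.left.Injective ∧ IsCounitSet (Set.range ε.left) := by
  have hδ : Function.Surjective (X.δ (1 : Fin 3)) := fun e => ⟨X.σ 0 e, X.δ_comp_σ_succ_apply 0 e⟩
  rw [SetSpan.biexact_iff]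
  constructor
  · rintro ⟨h₂, h₀⟩
    have hε : ε.left.Injective := injective_of_injective_pullback (d := X.δ 2) hδ h₂.1
    exact ⟨hε, (bijective_pullback_iff hε).1 h₂, (bijective_pullback_iff hε).1 h₀⟩
  · rintro ⟨hε, h⟩
    exact ⟨(bijective_pullback_iff hε).2 h.existsUnique_δ_two,
      (bijective_pullback_iff hε).2 h.existsUnique_δ_zero⟩

namespace SpanPseudomonoid.FrobeniusStructure

/-- Equivalence classes of Frobenius structures correspond to counit sets, namely to the image of
the left leg of their counit. -/
noncomputable def quotientEquivCounitSet (hX : X.IsTwoSegal) :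
    Quotient (setoid (X.pseudomonoid hX)) ≃ {E : Set (X _⦋1⦌) // IsCounitSet E} where
  toFun := Quotient.lift
    (fun F => ⟨Set.range F.counit.left, (biexact_mulSpan_comp_iff.1 F.biexact).2⟩)
    fun _ _ ⟨f⟩ => Subtype.ext f.range_left_eq
  invFun E := ⟦⟨SetSpan.ofSet E.1, biexact_mulSpan_comp_iff.2
    ⟨Subtype.val_injective, (Subtype.range_val (s := E.1)).symm ▸ E.2⟩⟩⟧
  left_inv := Quotient.ind fun F => Quotient.sound <|
    SetSpan.nonempty_iso_of_range_left_eq Subtype.val_injective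
      (biexact_mulSpan_comp_iff.1 F.biexact).1 Subtype.range_val
  right_inv _ := Subtype.ext Subtype.range_val

end SpanPseudomonoid.FrobeniusStructure

theorem SSet.ParacyclicStructure.biexact_mulSpan_comp_counitSpan (P : X.ParacyclicStructure)
    (hX : X.IsTwoSegal) : SetSpan.Biexact (X.mulSpan.comp P.counitSpan) := by
  have hσ : Function.Injective (X.σ (0 : Fin 1)) :=
    Function.LeftInverse.injective (X.δ_comp_σ_self_apply 0)
  exact biexact_mulSpan_comp_iff.2
    ⟨(P.τ 1).injective.comp hσ, P.toExtraDegeneracies.isCounitSet_range_s_zero hX⟩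

end Frobenius

theorem theorem4 (X : SSet.{u}) (hX : X.IsTwoSegal) :
    (∃ Φ : X.ParacyclicStructure ≃
        Quotient (SpanPseudomonoid.FrobeniusStructure.setoid (X.pseudomonoid hX)),
      ∀ P : X.ParacyclicStructure,
        ∃ F : SpanPseudomonoid.FrobeniusStructure (X.pseudomonoid hX),
          F.counit = P.counitSpan ∧ Φ P = Quotient.mk _ F) ∧
    (∃ Ψ : X.ParacyclicStructure ≃ X.ExtraDegeneracies,
      (∀ (P : X.ParacyclicStructure) (n : ℕ) (x : X _⦋n⦌),
        (Ψ P).s n x = P.τ (n + 1) (X.σ 0 x)) ∧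
      (∀ (E : X.ExtraDegeneracies) (n : ℕ) (x : X _⦋n⦌),
        (Ψ.symm E).τ n x = X.δ 0 (E.s n x))) := by
  let Ψ := SSet.ParacyclicStructure.equivExtraDegeneracies (X := X)
  let toSet := SSet.ExtraDegeneracies.equivCounitSet hX
  let classToSet := SpanPseudomonoid.FrobeniusStructure.quotientEquivCounitSet hX
  refine ⟨⟨(Ψ.trans toSet).trans classToSet.symm, fun P => ?_⟩, Ψ, fun _ _ _ => rfl,
    fun _ _ _ => rfl⟩
  exact ⟨⟨P.counitSpan, P.biexact_mulSpan_comp_counitSpan hX⟩, rfl,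
    classToSet.symm_apply_eq.2 rfl⟩
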